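/- Let $G$ be a finite simple graph that is a forest (i.e. has no cycles), with vertex set $V$, let $K$ be a field and $S=K[x_v : v\in V]$ the standard graded polynomial ring. A $k$-matching of $G$ is a set $M$ of $k$ pairwise disjoint edges of $G$; $V(M)$ denotes the set of vertices lying on the edges of $M$, and $\nu(G)$, the matching number, is the maximum size of a matching of $G$. Let $I(G)^{[k]}\subset S$ be the ideal generated by the monomials $\prod_{v\in V(M)}x_v$, where $M$ runs over all $k$-matchings of $G$ (the $k$-th squarefree power of the edge ideal of $G$). A matching $M$ of $G$ is called $k$-admissible if there are an integer $r\ge 1$ and non-empty, pairwise disjoint sets $M_1,\dots,M_r$ with $M=M_1\cup\dots\cup M_r$ such that - for all $i\ne j$, $e\in M_i$ and $e'\in M_j$, the set $\{e,e'\}$ is an induced matching of size $2$ of $G$ (no edge of $G$ joins a vertex of $e$ to a vertex of $e'$); - $|M_1|+\dots+|M_r|\le r+k-1$; - for every $i$, the induced subgraph of $G$ on $V(M_i)$ is a forest. Let $\mathrm{aim}(G,k)$, the $k$-admissible matching number, be the maximum size of a $k$-admissible matching of $G$ (and $0$ if there is none). For a homogeneous ideal $I\subset S$ let $\operatorname{reg}(I)=\sup\{j-i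 : \operatorname{Tor}_i^S(K,I)_j\neq 0\}$ be its Castelnuovo–Mumford regularity. Then for every integer $k$ with $1\le k\le\nu(G)$, $$\operatorname{reg}\bigl(I(G)^{[k]}\bigr)=\mathrm{aim}(G,k)+k.$$ -/

import Mathlib

noncomputable section

open scoped Classical in
/-- The set `V(M)` of all vertices lying on some edge of `M`. -/
def matchingVerts {V : Type*} [Fintype V] (M : Finset (Sym2 V)) : Finset V :=
  Finset.univ.filter fun v => ∃ e ∈ M, v ∈ e

/-- `M` is a matching of `G`: a set of pairwise disjoint edges. A `k`-matching is a matching with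
`M.card = k`. -/
def IsEdgeMatching {V : Type*} (G : SimpleGraph V) (M : Finset (Sym2 V)) : Prop :=
  (∀ e ∈ M, e ∈ G.edgeSet) ∧
    ∀ e ∈ M, ∀ e' ∈ M, e ≠ e' → Disjoint {v : V | v ∈ e} {v : V | v ∈ e'}

/-- `M` is an induced matching of `G`: a matching with `E(G_{V(M)}) = M`. -/
def IsInducedEdgeMatching {V : Type*} [Fintype V] (G : SimpleGraph V) (M : Finset (Sym2 V)) :
    Prop :=
  IsEdgeMatching G M ∧
    ((⊤ : G.Subgraph).induce (matchingVerts M : Set V)).edgeSet = (M : Set (Sym2 V))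

open scoped Classical in
/-- `{e, e'}` is a gap in `G`: an induced matching of size `2`. -/
def IsGap {V : Type*} [Fintype V] (G : SimpleGraph V) (e e' : Sym2 V) : Prop :=
  e ≠ e' ∧ IsInducedEdgeMatching G {e, e'}

/-- The matching number `ν(G)`: the maximum size of a matching of `G`. -/
def matchingNumber {V : Type*} [Fintype V] (G : SimpleGraph V) : ℕ :=
  sSup {m : ℕ | ∃ M : Finset (Sym2 V), IsEdgeMatching G M ∧ M.card = m}

/-- A sequence `(a₁, …, a_r)` of positive integers, with `r` positive, is `k`-admissible if
`a₁ + ⋯ + a_r ≤ r + k - 1`. -/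
def IsAdmissibleSequence (k : ℕ) {r : ℕ} (a : Fin r → ℕ) : Prop :=
  0 < r ∧ (∀ i, 0 < a i) ∧ ∑ i, a i ≤ r + k - 1

open scoped Classical in
/-- `M` is a `k`-admissible matching of `G`. -/
def IsAdmissibleMatching {V : Type*} [Fintype V] (G : SimpleGraph V) (k : ℕ)
    (M : Finset (Sym2 V)) : Prop :=
  IsEdgeMatching G M ∧
    ∃ (r : ℕ) (P : Fin r → Finset (Sym2 V)),
      (∀ i, (P i).Nonempty) ∧
      M = Finset.univ.biUnion P ∧
      (∀ i j, i ≠ j → Disjoint (P i) (P j)) ∧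
      (∀ i j, i ≠ j → ∀ e ∈ P i, ∀ e' ∈ P j, IsGap G e e') ∧
      IsAdmissibleSequence k (fun i => (P i).card) ∧
      ∀ i, (G.induce (matchingVerts (P i) : Set V)).IsAcyclic

/-- The `k`-admissible matching number `aim(G, k)`: the maximum size of a `k`-admissible matching
of `G`, and `0` if there is none. -/
def aim {V : Type*} [Fintype V] (G : SimpleGraph V) (k : ℕ) : ℕ :=
  sSup {m : ℕ | ∃ M : Finset (Sym2 V), IsAdmissibleMatching G k M ∧ M.card = m}

/-- The squarefree power `I(G)^{[k]}` of the edge ideal of `G` in `K[x_v : v ∈ V]`: the ideal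
generated by the monomials `∏_{v ∈ V(M)} x_v`, where `M` runs over the `k`-matchings of `G`. -/
def edgeIdealSquarefreePower (K : Type*) [Field K] {V : Type*} [Fintype V] (G : SimpleGraph V)
    (k : ℕ) : Ideal (MvPolynomial V K) :=
  Ideal.span {f | ∃ M : Finset (Sym2 V), IsEdgeMatching G M ∧ M.card = k ∧
    f = ∏ v ∈ matchingVerts M, MvPolynomial.X v}

/-! ### Graded Betti numbers and Castelnuovo–Mumford regularity

The Koszul complex of the variables, `K_i = ⊕_{|F| = i} S e_F` with
`∂ e_F = ∑_{v ∈ F} (-1)^{#{u ∈ F : u < v}} x_v e_{F \ {v}}` and `deg e_F = |F|`, is the minimal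
graded free resolution of `K = S / (x_v : v ∈ V)` over `S = K[x_v : v ∈ V]`. Hence
`Tor_i^S(K, I)_j` is the degree `j` part of the `i`-th homology of its tensor product with `I`. -/

/-- The Koszul differential, a function `c : Finset V → S` standing for `∑_F c_F e_F`. The order
on `V` only fixes the signs. -/
def koszulDifferential (K : Type*) [Field K] (V : Type*) [Fintype V] [LinearOrder V] :
    (Finset V → MvPolynomial V K) →ₗ[K] (Finset V → MvPolynomial V K) where
  toFun c := fun F => ∑ v ∈ Finset.univ \ F,
    (-1) ^ (F.filter (· < v)).card * MvPolynomial.X v * c (insert v F)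
  map_add' c c' := by
    funext F
    simp only [Pi.add_apply, mul_add, Finset.sum_add_distrib]
  map_smul' a c := by
    funext F
    simp only [Pi.smul_apply, mul_smul_comm, Finset.smul_sum, RingHom.id_apply]

/-- The Koszul differential squares to zero. -/
theorem koszulDifferential_comp_self (K : Type*) [Field K] (V : Type*) [Fintype V]
    [LinearOrder V] (c : Finset V → MvPolynomial V K) :
    koszulDifferential K V (koszulDifferential K V c) = 0 := by
  funext F
  simp only [koszulDifferential, LinearMap.coe_mk, AddHom.coe_mk, Finset.mul_sum, Pi.zero_apply]
  rw [Finset.sum_sigma']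
  have key : ∀ v w : V, v ∉ F → w ∉ F → v ≠ w → v < w →
      (-1 : MvPolynomial V K) ^ (F.filter (· < v)).card * MvPolynomial.X v *
          ((-1) ^ ((insert v F).filter (· < w)).card * MvPolynomial.X w *
            c (insert w (insert v F))) +
        (-1) ^ (F.filter (· < w)).card * MvPolynomial.X w *
          ((-1) ^ ((insert w F).filter (· < v)).card * MvPolynomial.X v *
            c (insert v (insert w F))) = 0 := by
    intro v w hv hw _ h
    rw [Finset.filter_insert, if_pos h, Finset.filter_insert, if_neg h.not_gt,
      Finset.card_insert_of_notMem (by simp [hv]), Finset.insert_comm w v]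
    ring
  refine Finset.sum_involution (fun p _ => ⟨p.2, p.1⟩) ?_ ?_ ?_ ?_
  · rintro ⟨v, w⟩ h
    simp only [Finset.mem_sigma, Finset.mem_sdiff, Finset.mem_univ, true_and, Finset.mem_insert,
      not_or] at h
    rcases lt_or_gt_of_ne h.2.1 with hlt | hlt
    · rw [add_comm]
      exact key w v h.2.2 h.1 h.2.1 hlt
    · exact key v w h.1 h.2.2 (Ne.symm h.2.1) hlt
  · rintro ⟨v, w⟩ h _ he
    simp only [Finset.mem_sigma, Finset.mem_sdiff, Finset.mem_univ, true_and, Finset.mem_insert,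
      not_or] at h
    simp only [Sigma.mk.injEq] at he
    exact h.2.1 he.1
  · rintro ⟨v, w⟩ h
    simp only [Finset.mem_sigma, Finset.mem_sdiff, Finset.mem_univ, true_and, Finset.mem_insert,
      not_or] at h ⊢
    exact ⟨h.2.2, Ne.symm h.2.1, h.1⟩
  · rintro ⟨v, w⟩ _
    rfl

/-- The degree `j` part of `K_i ⊗ I`: the sums `∑_F c_F e_F` with all `c_F ∈ I`, in which only
terms `x^m e_F` with `|F| = i` and `deg (x^m) + |F| = j` occur. -/
def koszulChains {K : Type*} [Field K] {V : Type*} (I : Ideal (MvPolynomial V K)) (i j : ℕ) :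
    Submodule K (Finset V → MvPolynomial V K) where
  carrier := {c | ∀ F, c F ∈ I ∧ ∀ m ∈ (c F).support, F.card = i ∧ m.degree + F.card = j}
  zero_mem' := fun F => ⟨I.zero_mem, fun m hm => by simp at hm⟩
  add_mem' := by
    classical
    intro a b ha hb F
    refine ⟨I.add_mem (ha F).1 (hb F).1, fun m hm => ?_⟩
    rcases Finset.mem_union.1 (MvPolynomial.support_add hm) with h | h
    · exact (ha F).2 m h
    · exact (hb F).2 m h
  smul_mem' := by
    intro r a ha F
    refine ⟨?_, fun m hm => (ha F).2 m (MvPolynomial.support_smul hm)⟩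
    rw [Pi.smul_apply, MvPolynomial.smul_eq_C_mul]
    exact I.mul_mem_left _ (ha F).1

/-- The cycles of `(K_• ⊗ I)_j` in homological degree `i`. -/
def koszulCycles {K : Type*} [Field K] {V : Type*} [Fintype V] [LinearOrder V]
    (I : Ideal (MvPolynomial V K)) (i j : ℕ) : Submodule K (Finset V → MvPolynomial V K) :=
  koszulChains I i j ⊓ LinearMap.ker (koszulDifferential K V)

/-- The boundaries of `(K_• ⊗ I)_j` in homological degree `i`. -/
def koszulBoundaries {K : Type*} [Field K] {V : Type*} [Fintype V] [LinearOrder V]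
    (I : Ideal (MvPolynomial V K)) (i j : ℕ) : Submodule K (Finset V → MvPolynomial V K) :=
  (koszulChains I (i + 1) j).map (koszulDifferential K V)

/-- Boundaries are cycles, so `gradedTor` below is the full homology. -/
theorem koszulBoundaries_le_koszulCycles {K : Type*} [Field K] {V : Type*} [Fintype V]
    [LinearOrder V] (I : Ideal (MvPolynomial V K)) (i j : ℕ) :
    koszulBoundaries I i j ≤ koszulCycles I i j := by
  rintro _ ⟨c, hc, rfl⟩
  refine ⟨fun F => ?_, koszulDifferential_comp_self K V c⟩
  simp only [koszulDifferential, LinearMap.coe_mk, AddHom.coe_mk]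
  refine ⟨I.sum_mem fun v _ => I.mul_mem_left _ (hc _).1, fun m hm => ?_⟩
  obtain ⟨v, hv, hmv⟩ : ∃ v ∈ Finset.univ \ F, m ∈ ((-1) ^ (F.filter (· < v)).card *
      MvPolynomial.X v * c (insert v F)).support := by
    have := MvPolynomial.support_sum hm
    simpa using this
  have hvF : v ∉ F := (Finset.mem_sdiff.1 hv).2
  have hm' : m ∈ (MvPolynomial.X v * c (insert v F)).support := by
    rcases neg_one_pow_eq_or (MvPolynomial V K) (F.filter (· < v)).card with h | h <;>
      rw [h] at hmv <;> simpa using hmv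
  rw [MvPolynomial.support_X_mul, Finset.mem_map] at hm'
  obtain ⟨m', hm', rfl⟩ := hm'
  have := (hc (insert v F)).2 m' hm'
  rw [Finset.card_insert_of_notMem hvF] at this
  simp only [addLeftEmbedding_apply, map_add, Finsupp.degree_single]
  omega

/-- The `K`-vector space `Tor_i^S(K, I)_j`. -/
abbrev gradedTor {K : Type*} [Field K] {V : Type*} [Fintype V] [LinearOrder V]
    (I : Ideal (MvPolynomial V K)) (i j : ℕ) : Type _ :=
  koszulCycles I i j ⧸ (koszulBoundaries I i j).submoduleOf (koszulCycles I i j)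

/-- The graded Betti number `β_{i,j}(I) = dim_K Tor_i^S(K, I)_j`. -/
def gradedBetti {K : Type*} [Field K] {V : Type*} [Fintype V] [LinearOrder V]
    (I : Ideal (MvPolynomial V K)) (i j : ℕ) : ℕ :=
  Module.finrank K (gradedTor I i j)

/-- The Castelnuovo–Mumford regularity `reg(I) = sup {j - i : β_{i,j}(I) ≠ 0}` of a homogeneous
ideal, where `reg(0) = -∞`. -/
def regularity {K : Type*} [Field K] {V : Type*} [Fintype V] [LinearOrder V]
    (I : Ideal (MvPolynomial V K)) : WithBot (WithTop ℤ) :=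
  sSup {r | ∃ i j : ℕ, gradedBetti I i j ≠ 0 ∧ r = (((j : ℤ) - (i : ℤ) : ℤ) : WithTop ℤ)}

end

/-!
Membership in a squarefree monomial ideal only depends on the supports of monomials, so such ideals
are treated as monotone predicates on `Finset V`, and their regularity is bounded directly on Koszul
chains (`RegLE`). Admissible matchings are rephrased through vertex colourings: a matching `M` whose
vertices are coloured so that adjacent vertices have equal colours is admissible when
`|M| ≤ #colours + k - 1` (`IsColouredAdmissible`).

Upper bound. For a squarefree monomial ideal `I` and a variable `x_v`, `reg I` is at most the
maximum of `reg (I : x_v) + 1` and the regularity of the ideal of those monomials of `I` that do not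
involve `x_v` (`RegLE.of_colon_of_delete`). A forest with an edge has a leaf `x` whose neighbour `y`
has at most one non-leaf neighbour `z` (`SimpleGraph.IsAcyclic.exists_distant_leaf`). Splitting with
respect to `y`, then the leaves at `y`, then `z`, produces only squarefree powers of smaller induced
subgraphs, because the colon of the `(k+1)`-st power by both ends of a leaf edge is the `k`-th power
after removal of that edge (`hasMatchingIn_leaf_iff`). The drop in regularity that this needs comes
from the fact that admissible matchings of these subgraphs can be enlarged by the edge `xy`
(`IsColouredAdmissible.exists_insert`).

Lower bound. Let `M` be an admissible matching of maximal size, so `|M| ≥ k`, with its parts merged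
into exactly `t + 1 = |M| - k + 1` colours, and let `X` consist of one vertex of each colour. The
sets `F ⊆ V(M)` such that `G` still has a `k`-matching in `V(M) \ F` form a simplicial complex that
contains all proper subsets of `X` but no set meeting all colours. Hence the colouring retracts it
onto a sphere of dimension `t - 1`, which gives a nonzero Koszul class in homological degree `t` and
internal degree `2|M|` (`exists_cycle_not_boundary`), and `2|M| - t = |M| + k`.
-/

open MvPolynomial

/-! ### Koszul chains of squarefree monomial ideals -/

/-- The degree `j` part of `K_i ⊗ I`, where `I` is the squarefree monomial ideal with
`x^m ∈ I ↔ P (supp m)`. Squarefree monomial ideals are encoded throughout by such predicates `P`,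
monotone in the applications. -/
def supportChains (K : Type*) [Field K] {V : Type*} (P : Finset V → Prop) (i j : ℕ) :
    Submodule K (Finset V → MvPolynomial V K) where
  carrier := {c | ∀ F m, coeff m (c F) ≠ 0 → P m.support ∧ F.card = i ∧ m.degree + F.card = j}
  zero_mem' := fun F m hm => by simp at hm
  add_mem' := by
    intro a b ha hb F m hm
    by_cases h : coeff m (a F) = 0
    · refine hb F m fun h' => hm ?_
      rw [Pi.add_apply, coeff_add, h, h', add_zero]
    · exact ha F m h
  smul_mem' := by
    intro r a ha F m hm
    refine ha F m fun h => hm ?_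
    rw [Pi.smul_apply, coeff_smul, h, smul_zero]

/-- `reg I ≤ n` for the squarefree monomial ideal `I` encoded by `P`: the Koszul complex of `I` is
exact in homological degree `i` and internal degree `j` whenever `j - i > n`. -/
def RegLE (K : Type*) [Field K] {V : Type*} [Fintype V] [LinearOrder V] (P : Finset V → Prop)
    (n : ℕ) : Prop :=
  ∀ i j, n + i < j → ∀ c ∈ supportChains K P i j, koszulDifferential K V c = 0 →
    ∃ b ∈ supportChains K P (i + 1) j, koszulDifferential K V b = c

section Koszul

variable {K : Type*} [Field K] {V : Type*}

theorem coeff_sign_mul (n : ℕ) (p : MvPolynomial V K) (m : V →₀ ℕ) :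
    coeff m ((-1) ^ n * p) = (-1) ^ n * coeff m p := by
  have : ((-1) ^ n : MvPolynomial V K) = C ((-1) ^ n) := by simp
  rw [this, coeff_C_mul]

theorem tsub_single_add_single {m : V →₀ ℕ} {v : V} (h : v ∈ m.support) :
    m - Finsupp.single v 1 + Finsupp.single v 1 = m := by
  classical
  refine tsub_add_cancel_of_le ?_
  rw [Finsupp.single_le_iff]
  exact Nat.one_le_iff_ne_zero.2 (Finsupp.mem_support_iff.1 h)

theorem support_add_single [DecidableEq V] (m : V →₀ ℕ) (v : V) :
    (m + Finsupp.single v 1).support = insert v m.support := by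
  ext u
  by_cases h : u = v
  · subst h; simp
  · simp [h]

theorem coeff_modMonomial_ne_zero {p : MvPolynomial V K} {v : V} {m : V →₀ ℕ}
    (h : coeff m (p.modMonomial (Finsupp.single v 1)) ≠ 0) : m v = 0 ∧ coeff m p ≠ 0 := by
  have hle : ¬ Finsupp.single v 1 ≤ m := fun hle => h (coeff_modMonomial_of_le _ hle)
  rw [coeff_modMonomial_of_not_le _ hle] at h
  refine ⟨?_, h⟩
  rw [Finsupp.single_le_iff] at hle
  omega

theorem X_mul_mem_supportChains [DecidableEq V] {P P' : Finset V → Prop} {v : V}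
    (h : ∀ F, P' F → P (insert v F)) {i j : ℕ} {b : Finset V → MvPolynomial V K}
    (hb : b ∈ supportChains K P' i j) :
    (fun F => X v * b F) ∈ supportChains K P i (j + 1) := by
  intro F m hm
  rw [coeff_X_mul'] at hm
  split_ifs at hm with hv
  · obtain ⟨m', hm'⟩ : ∃ m', m' + Finsupp.single v 1 = m := ⟨_, tsub_single_add_single hv⟩
    rw [← hm', add_tsub_cancel_right] at hm
    obtain ⟨h1, h2, h3⟩ := hb _ _ hm
    rw [← hm', support_add_single]
    refine ⟨h _ h1, h2, ?_⟩
    simp only [map_add, Finsupp.degree_single]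
    omega
  · exact absurd rfl hm

theorem supportChains_mono {P P' : Finset V → Prop} (h : ∀ F, P F → P' F) {i j : ℕ} :
    supportChains K P i j ≤ supportChains K P' i j :=
  fun _ hb F m hm => ⟨h _ (hb F m hm).1, (hb F m hm).2⟩

variable [Fintype V] [LinearOrder V]

theorem coeff_koszulDifferential (c : Finset V → MvPolynomial V K) (F : Finset V) (m : V →₀ ℕ) :
    coeff m (koszulDifferential K V c F) = ∑ v ∈ Finset.univ \ F,
      (-1) ^ (F.filter (· < v)).card *
        if v ∈ m.support then coeff (m - Finsupp.single v 1) (c (insert v F)) else 0 := by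
  simp only [koszulDifferential, LinearMap.coe_mk, AddHom.coe_mk, coeff_sum]
  refine Finset.sum_congr rfl fun v _ => ?_
  rw [mul_assoc, coeff_sign_mul, coeff_X_mul']

theorem exists_of_coeff_koszulDifferential_ne_zero {c : Finset V → MvPolynomial V K}
    {F : Finset V} {m : V →₀ ℕ} (h : coeff m (koszulDifferential K V c F) ≠ 0) :
    ∃ v m', v ∉ F ∧ m = m' + Finsupp.single v 1 ∧ coeff m' (c (insert v F)) ≠ 0 := by
  rw [coeff_koszulDifferential] at h
  obtain ⟨v, hv, hne⟩ := Finset.exists_ne_zero_of_sum_ne_zero h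
  have h1 := right_ne_zero_of_mul hne
  have hvm : v ∈ m.support := by
    by_contra h'
    exact h1 (if_neg h')
  rw [if_pos hvm] at h1
  exact ⟨v, _, by simpa using hv, (tsub_single_add_single hvm).symm, h1⟩

theorem koszulDifferential_mem_supportChains {P : Finset V → Prop} (hP : Monotone P) {i j : ℕ}
    {c : Finset V → MvPolynomial V K} (hc : c ∈ supportChains K P (i + 1) j) :
    koszulDifferential K V c ∈ supportChains K P i j := by
  intro F m hm
  obtain ⟨v, m', hv, rfl, h⟩ := exists_of_coeff_koszulDifferential_ne_zero hm
  obtain ⟨h1, h2, h3⟩ := hc _ _ h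
  rw [Finset.card_insert_of_notMem hv] at h2 h3
  refine ⟨hP ?_ h1, by omega, ?_⟩
  · rw [support_add_single]
    exact Finset.subset_insert _ _
  · simp only [map_add, Finsupp.degree_single]
    omega

/-- Chains in homological degree `0` are killed by the differential. -/
theorem koszulDifferential_eq_zero {P : Finset V → Prop} {j : ℕ}
    {c : Finset V → MvPolynomial V K} (hc : c ∈ supportChains K P 0 j) :
    koszulDifferential K V c = 0 := by
  funext F
  ext m
  by_contra hm
  obtain ⟨v, m', hv, rfl, h⟩ := exists_of_coeff_koszulDifferential_ne_zero hm
  have := (hc _ _ h).2.1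
  rw [Finset.card_insert_of_notMem hv] at this
  omega

theorem koszulDifferential_X_mul (v : V) (c : Finset V → MvPolynomial V K) :
    koszulDifferential K V (fun F => X v * c F) = fun F => X v * koszulDifferential K V c F := by
  funext F
  simp only [koszulDifferential, LinearMap.coe_mk, AddHom.coe_mk, Finset.mul_sum]
  refine Finset.sum_congr rfl fun u _ => ?_
  ring

/-- Every Koszul cycle over the polynomial ring is homologous to a cycle in which a given variable
`x_v` occurs neither in the coefficients nor in the basis elements. -/
theorem exists_boundary_eliminating (v : V) {i j : ℕ} {c : Finset V → MvPolynomial V K}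
    (hc : c ∈ supportChains K (fun _ => True) i j) (hc0 : koszulDifferential K V c = 0) :
    ∃ b ∈ supportChains K (fun _ : Finset V => True) (i + 1) j,
      ∀ F m, coeff m ((c - koszulDifferential K V b) F) ≠ 0 →
        v ∉ F ∧ m v = 0 ∧ coeff m (c F) ≠ 0 := by
  -- The contracting homotopy for `x_v`: a term `x_v m e_F` with `v ∉ F` goes to `± m e_(F ∪ v)`.
  let b : Finset V → MvPolynomial V K := fun F => if v ∈ F then
    (-1) ^ ((F.erase v).filter (· < v)).card *
      (c (F.erase v)).divMonomial (Finsupp.single v 1) else 0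
  have hdb : ∀ F, v ∉ F → koszulDifferential K V b F =
      X v * (c F).divMonomial (Finsupp.single v 1) := by
    intro F hF
    simp only [koszulDifferential, LinearMap.coe_mk, AddHom.coe_mk]
    rw [Finset.sum_eq_single_of_mem v (by simp [hF])]
    · simp only [b, Finset.mem_insert_self, if_true, Finset.erase_insert hF]
      rw [mul_mul_mul_comm, ← pow_add, ← two_mul, pow_mul]
      simp
    · intro u _ hu
      simp [b, Ne.symm hu, hF]
  have hmod : ∀ F, v ∉ F → (c - koszulDifferential K V b) F =
      (c F).modMonomial (Finsupp.single v 1) := by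
    intro F hF
    rw [Pi.sub_apply, hdb F hF, sub_eq_iff_eq_add, add_comm]
    exact (divMonomial_add_modMonomial_single _ _).symm
  have hd : koszulDifferential K V (c - koszulDifferential K V b) = 0 := by
    rw [map_sub, hc0, koszulDifferential_comp_self, sub_zero]
  refine ⟨b, ?_, ?_⟩
  · intro F m hm
    by_cases hF : v ∈ F
    · simp only [b, if_pos hF, coeff_sign_mul] at hm
      have := right_ne_zero_of_mul hm
      rw [coeff_divMonomial] at this
      obtain ⟨-, h2, h3⟩ := hc _ _ this
      have h4 := Finset.card_erase_add_one hF
      simp only [map_add, Finsupp.degree_single] at h3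
      exact ⟨trivial, by omega, by omega⟩
    · simp [b, hF] at hm
  · intro F m hm
    have hF : v ∉ F := by
      intro hF
      apply hm
      have h0 := congrArg (coeff (m + Finsupp.single v 1)) (congrFun hd (F.erase v))
      rw [coeff_koszulDifferential,
        Finset.sum_eq_single_of_mem v (by simp)] at h0
      · rw [support_add_single, if_pos (Finset.mem_insert_self _ _), add_tsub_cancel_right,
          Finset.insert_erase hF] at h0
        simpa using h0
      · intro u hu huv
        split_ifs with hum
        · rw [hmod _ (by simp [Ne.symm huv]), coeff_modMonomial_of_le, mul_zero]
          rw [Finsupp.single_le_iff]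
          simp [huv]
        · simp
    rw [hmod F hF] at hm
    exact ⟨hF, coeff_modMonomial_ne_zero hm⟩

/-! ### Bounds for the regularity of squarefree monomial ideals -/

/-- The polynomial ring has regularity `0`, i.e. the Koszul complex resolves `K`: a cycle of
positive degree is a boundary, as all variables can be eliminated from it. -/
theorem regLE_true : RegLE K (fun _ : Finset V => True) 0 := by
  intro i j hij c hc hc0
  have key : ∀ T : Finset V, ∃ b ∈ supportChains K (fun _ : Finset V => True) (i + 1) j,
      ∀ F m, coeff m ((c - koszulDifferential K V b) F) ≠ 0 →
        ∀ v ∈ T, v ∉ F ∧ m v = 0 := by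
    intro T
    induction T using Finset.induction_on with
    | empty => exact ⟨0, Submodule.zero_mem _, by simp⟩
    | insert v T hv ih =>
      obtain ⟨b, hb, hbT⟩ := ih
      obtain ⟨b', hb', hbT'⟩ := exists_boundary_eliminating v
        (c := c - koszulDifferential K V b)
        (Submodule.sub_mem _ hc (koszulDifferential_mem_supportChains (fun _ _ _ h => h) hb))
        (by rw [map_sub, hc0, koszulDifferential_comp_self, sub_zero])
      refine ⟨b + b', Submodule.add_mem _ hb hb', fun F m hm u hu => ?_⟩
      rw [map_add, ← sub_sub] at hm
      obtain ⟨h1, h2, h3⟩ := hbT' F m hm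
      rcases Finset.mem_insert.1 hu with rfl | hu
      · exact ⟨h1, h2⟩
      · exact hbT F m h3 u hu
  obtain ⟨b, hb, hbT⟩ := key Finset.univ
  refine ⟨b, hb, ?_⟩
  symm
  rw [← sub_eq_zero]
  funext F
  ext m
  by_contra hm
  have hF : F = ∅ := Finset.eq_empty_of_forall_notMem fun v =>
    (hbT F m hm v (Finset.mem_univ v)).1
  have hm0 : m = 0 := Finsupp.ext fun v => (hbT F m hm v (Finset.mem_univ v)).2
  have := (Submodule.sub_mem _ hc
    (koszulDifferential_mem_supportChains (fun _ _ _ h => h) hb) F m hm).2.2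
  rw [hF, hm0] at this
  simp at this
  omega

theorem RegLE.mono {P : Finset V → Prop} {n n' : ℕ} (h : RegLE K P n) (hn : n ≤ n') :
    RegLE K P n' :=
  fun i j hij => h i j (by omega)

theorem regLE_of_forall_not {P : Finset V → Prop} (h : ∀ F, ¬ P F) (n : ℕ) : RegLE K P n := by
  intro i j _ c hc _
  refine ⟨0, Submodule.zero_mem _, ?_⟩
  rw [map_zero]
  funext F
  ext m
  by_contra hm
  exact h _ (hc F m (Ne.symm hm)).1

/-- `reg I ≤ max (reg (I : x_v) + 1) (reg I')`, where `I'` is generated by the monomials of `I` that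
are not divisible by `x_v`. This is the exact sequence
`0 → x_v I' → I' ⊕ x_v (I : x_v) → I → 0` on Koszul homology. -/
theorem RegLE.of_colon_of_delete {P : Finset V → Prop} (hP : Monotone P) (v : V) {n : ℕ}
    (h₁ : RegLE K (fun F => P (insert v F)) n) (h₂ : RegLE K (fun F => P (F.erase v)) (n + 1)) :
    RegLE K P (n + 1) := by
  have hP' : Monotone fun F : Finset V => P (F.erase v) := fun A B h =>
    hP (Finset.erase_subset_erase v h)
  intro i j hij c hc hc0
  obtain ⟨j, rfl⟩ : ∃ j', j = j' + 1 := ⟨j - 1, by omega⟩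
  -- `c = a + x_v b`, where `a` collects the terms that are not divisible by `x_v`.
  obtain ⟨a, ha⟩ : ∃ a : Finset V → MvPolynomial V K,
    a = fun F => (c F).modMonomial (Finsupp.single v 1) := ⟨_, rfl⟩
  obtain ⟨b, hb⟩ : ∃ b : Finset V → MvPolynomial V K,
    b = fun F => (c F).divMonomial (Finsupp.single v 1) := ⟨_, rfl⟩
  have hab : c = a + fun F => X v * b F := by
    funext F
    rw [Pi.add_apply, add_comm, ha, hb]
    exact (divMonomial_add_modMonomial_single _ _).symm
  replace ha : a ∈ supportChains K (fun F => P (F.erase v)) i (j + 1) := by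
    intro F m hm
    rw [ha] at hm
    obtain ⟨h1, h2⟩ := coeff_modMonomial_ne_zero hm
    obtain ⟨h3, h4⟩ := hc _ _ h2
    refine ⟨?_, h4⟩
    have hv : m.support.erase v = m.support := Finset.erase_eq_of_notMem (by simpa using h1)
    change P (m.support.erase v)
    rwa [hv]
  replace hb : b ∈ supportChains K (fun F => P (insert v F)) i j := by
    intro F m hm
    rw [hb] at hm
    simp only [coeff_divMonomial] at hm
    obtain ⟨h1, h2, h3⟩ := hc _ _ hm
    rw [add_comm, support_add_single] at h1
    simp only [map_add, Finsupp.degree_single] at h3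
    exact ⟨h1, h2, by omega⟩
  have hda : koszulDifferential K V a = -fun F => X v * koszulDifferential K V b F := by
    rw [hab, map_add, koszulDifferential_X_mul] at hc0
    exact eq_neg_of_add_eq_zero_left hc0
  -- The two parts of `c` are corrected by `x_v d` and `d`, so that both become cycles.
  obtain ⟨d, hd, hdb⟩ : ∃ d ∈ supportChains K (fun F => P (F.erase v)) i j,
      koszulDifferential K V d = -koszulDifferential K V b := by
    rcases i with _ | i
    · refine ⟨0, Submodule.zero_mem _, ?_⟩
      rw [koszulDifferential_eq_zero hb, map_zero, neg_zero]
    · refine h₂ i j (by omega) _ (Submodule.neg_mem _ ?_) ?_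
      · intro F m hm
        have h0 := koszulDifferential_mem_supportChains hP' ha F (m + Finsupp.single v 1)
        rw [hda, Pi.neg_apply, coeff_neg, mul_comm, coeff_mul_X, support_add_single] at h0
        obtain ⟨h1, h2, h3⟩ := h0 (neg_ne_zero.2 hm)
        simp only [map_add, Finsupp.degree_single] at h3
        have h4 : (insert v m.support).erase v = m.support.erase v := by
          ext u; simp
        rw [h4] at h1
        exact ⟨h1, h2, by omega⟩
      · rw [map_neg, koszulDifferential_comp_self, neg_zero]
  obtain ⟨a', ha', haa⟩ := h₂ i (j + 1) (by omega) (a - fun F => X v * d F)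
    (Submodule.sub_mem _ ha (X_mul_mem_supportChains (P := fun F => P (F.erase v)) (v := v)
      (fun F h => hP (Finset.erase_subset_erase v (Finset.subset_insert v F)) h) hd)) (by
      rw [map_sub, koszulDifferential_X_mul, hda, hdb]
      funext F
      simp)
  obtain ⟨b', hb', hbb⟩ := h₁ i j (by omega) (b + d) (Submodule.add_mem _ hb
      (supportChains_mono (fun F h =>
        hP ((Finset.erase_subset v F).trans (Finset.subset_insert v F)) h) hd)) (by
      rw [map_add, hdb, add_neg_cancel])
  refine ⟨a' + fun F => X v * b' F, Submodule.add_mem _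
    (supportChains_mono (fun F h => hP (Finset.erase_subset v F) h) ha')
    (X_mul_mem_supportChains (fun _ h => h) hb'), ?_⟩
  rw [map_add, koszulDifferential_X_mul, haa, hbb, hab]
  funext F
  simp only [Pi.add_apply, Pi.sub_apply]
  ring

end Koszul

/-! ### Leaves of forests -/

namespace SimpleGraph

variable {V : Type*} [Finite V] {G : SimpleGraph V}

/-- A forest with an edge has a leaf `x` whose neighbour `y` has at most one neighbour `z` that is
not a leaf: `x`, `y`, `z` are the first vertices of a path of maximal length. -/
theorem IsAcyclic.exists_distant_leaf (hG : G.IsAcyclic) {a b : V} (hab : G.Adj a b) :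
    ∃ x y z, G.Adj x y ∧ (∀ w, G.Adj x w → w = y) ∧
      ∀ u, G.Adj y u → (∀ w, G.Adj u w → w = y) ∨ u = z := by
  classical
  have := Fintype.ofFinite V
  obtain ⟨n, ⟨u, v, p, hp, hn⟩, hmax⟩ : ∃ n, (∃ u v, ∃ p : G.Walk u v, p.IsPath ∧ p.length = n) ∧
      ∀ m, (∃ u v, ∃ p : G.Walk u v, p.IsPath ∧ p.length = m) → m ≤ n := by
    have hne : {m | ∃ u v, ∃ p : G.Walk u v, p.IsPath ∧ p.length = m}.Nonempty :=
      ⟨0, a, a, Walk.nil, Walk.IsPath.nil, rfl⟩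
    have hbdd : BddAbove {m | ∃ u v, ∃ p : G.Walk u v, p.IsPath ∧ p.length = m} := by
      refine ⟨Fintype.card V, ?_⟩
      rintro m ⟨u, v, p, hp, rfl⟩
      exact hp.length_lt.le
    exact ⟨_, Nat.sSup_mem hne hbdd, fun m hm => le_csSup hbdd hm⟩
  have hpos : 1 ≤ n := hmax 1 ⟨a, b, hab.toWalk, by simp [hab.ne], rfl⟩
  have hleaf : ∀ {u v : V} {p : G.Walk u v}, p.IsPath → p.length = n →
      ∀ w, G.Adj u w → w = p.snd := by
    intro u v p hp hn w hw
    by_cases hwp : w ∈ p.support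
    · exact hG.eq_snd_of_adj_start hp hw hwp
    · have := hmax _ ⟨w, v, Walk.cons hw.symm p, by simp [hp, hwp], rfl⟩
      rw [Walk.length_cons] at this
      omega
  cases p with
  | nil => simp at hn; omega
  | @cons _ y _ h p' =>
    refine ⟨u, y, p'.snd, h, fun w hw => by simpa using hleaf hp hn w hw, fun u' hu' => ?_⟩
    by_cases hwp : u' ∈ p'.support
    · exact Or.inr (hG.eq_snd_of_adj_start hp.of_cons hu' hwp)
    · refine Or.inl fun w hw => ?_
      have hp' : (Walk.cons hu'.symm p').IsPath := by simp [hp.of_cons, hwp]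
      simpa using hleaf hp' (by simpa using hn) w hw

theorem IsAcyclic.exists_distant_leaf_of_mem (hG : G.IsAcyclic) {W : Finset V} {a b : V}
    (hab : G.Adj a b) (ha : a ∈ W) (hb : b ∈ W) :
    ∃ x ∈ W, ∃ y ∈ W, ∃ z, G.Adj x y ∧ (∀ w ∈ W, G.Adj x w → w = y) ∧
      ∀ u ∈ W, G.Adj y u → (∀ w ∈ W, G.Adj u w → w = y) ∨ u = z := by
  let H : SimpleGraph V :=
    { Adj := fun a b => a ∈ W ∧ b ∈ W ∧ G.Adj a b
      symm := ⟨fun _ _ h => ⟨h.2.1, h.1, h.2.2.symm⟩⟩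
      loopless := ⟨fun _ h => G.irrefl h.2.2⟩ }
  have hH : H.IsAcyclic := hG.anti fun _ _ h => h.2.2
  obtain ⟨x, y, z, ⟨hx, hy, hxy⟩, h1, h2⟩ :=
    hH.exists_distant_leaf (show H.Adj a b from ⟨ha, hb, hab⟩)
  refine ⟨x, hx, y, hy, z, hxy, fun w hw h => h1 w ⟨hx, hw, h⟩, fun u hu h => ?_⟩
  exact (h2 u ⟨hy, hu, h⟩).imp_left fun h w hw huw => h w ⟨hu, hw, huw⟩

end SimpleGraph

/-! ### Matchings inside a set of vertices -/

section Matchings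

variable {V : Type*} {G : SimpleGraph V}

theorem IsEdgeMatching.subset {M N : Finset (Sym2 V)} (hN : IsEdgeMatching G N) (h : M ⊆ N) :
    IsEdgeMatching G M :=
  ⟨fun e he => hN.1 e (h he), fun e he e' he' => hN.2 e (h he) e' (h he')⟩

theorem IsEdgeMatching.eq_of_mem {M : Finset (Sym2 V)} (hM : IsEdgeMatching G M) {e e' : Sym2 V}
    (he : e ∈ M) (he' : e' ∈ M) {v : V} (hv : v ∈ e) (hv' : v ∈ e') : e = e' := by
  by_contra h
  exact Set.disjoint_left.1 (hM.2 e he e' he' h) hv hv'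

variable [Fintype V]

theorem mem_matchingVerts {M : Finset (Sym2 V)} {v : V} :
    v ∈ matchingVerts M ↔ ∃ e ∈ M, v ∈ e := by
  simp [matchingVerts]

theorem matchingVerts_mono {M N : Finset (Sym2 V)} (h : M ⊆ N) :
    matchingVerts M ⊆ matchingVerts N := fun v hv => by
  obtain ⟨e, he, hve⟩ := mem_matchingVerts.1 hv
  exact mem_matchingVerts.2 ⟨e, h he, hve⟩

theorem IsEdgeMatching.exists_adj {M : Finset (Sym2 V)} (hM : IsEdgeMatching G M) {e : Sym2 V}
    (he : e ∈ M) {v : V} (hv : v ∈ e) : ∃ w, e = s(v, w) ∧ G.Adj v w ∧ w ∈ matchingVerts M := by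
  obtain ⟨w, rfl⟩ := Sym2.mem_iff_exists.1 hv
  exact ⟨w, rfl, hM.1 _ he, mem_matchingVerts.2 ⟨_, he, by simp⟩⟩

theorem matchingVerts_insert [DecidableEq V] {M : Finset (Sym2 V)} {x y : V} :
    matchingVerts (insert s(x, y) M) = insert x (insert y (matchingVerts M)) := by
  ext v
  simp [mem_matchingVerts, or_assoc]

theorem IsEdgeMatching.insert [DecidableEq V] {M : Finset (Sym2 V)} (hM : IsEdgeMatching G M)
    {x y : V} (hxy : G.Adj x y) (hx : x ∉ matchingVerts M) (hy : y ∉ matchingVerts M) :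
    IsEdgeMatching G (insert s(x, y) M) ∧ (insert s(x, y) M).card = M.card + 1 := by
  have hdis : ∀ e ∈ M, ∀ v ∈ e, v ∉ s(x, y) := by
    intro e he v hv hv'
    rcases Sym2.mem_iff.1 hv' with rfl | rfl
    · exact hx (mem_matchingVerts.2 ⟨e, he, hv⟩)
    · exact hy (mem_matchingVerts.2 ⟨e, he, hv⟩)
  refine ⟨⟨?_, ?_⟩, ?_⟩
  · intro e he
    rcases Finset.mem_insert.1 he with rfl | he
    · exact hxy
    · exact hM.1 e he
  · intro e he e' he' hne
    rcases Finset.mem_insert.1 he with rfl | he <;> rcases Finset.mem_insert.1 he' with rfl | he'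
    · exact absurd rfl hne
    · exact Set.disjoint_left.2 fun v hv hv' => hdis e' he' v hv' hv
    · exact Set.disjoint_left.2 fun v hv hv' => hdis e he v hv hv'
    · exact hM.2 e he e' he' hne
  · refine Finset.card_insert_of_notMem fun h => hdis _ h x (by simp) (by simp)

variable (G) in
/-- `G` has a `k`-matching all of whose vertices lie in `A`. For fixed `W` and `k`, the predicate
`fun F => HasMatchingIn G k (W ∩ F)` encodes the `k`-th squarefree power of the edge ideal of the
subgraph of `G` induced on `W`. -/
def HasMatchingIn (k : ℕ) (A : Finset V) : Prop :=
  ∃ M : Finset (Sym2 V), IsEdgeMatching G M ∧ M.card = k ∧ matchingVerts M ⊆ A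

theorem HasMatchingIn.mono {k : ℕ} : Monotone (HasMatchingIn G k) :=
  fun _ _ h ⟨M, hM, hk, hA⟩ => ⟨M, hM, hk, hA.trans h⟩

theorem IsEdgeMatching.hasMatchingIn {M : Finset (Sym2 V)} (hM : IsEdgeMatching G M) {k : ℕ}
    (hk : k ≤ M.card) {A : Finset V} (hA : matchingVerts M ⊆ A) : HasMatchingIn G k A := by
  obtain ⟨N, hN, hNk⟩ := Finset.exists_subset_card_eq hk
  exact ⟨N, hM.subset hN, hNk, (matchingVerts_mono hN).trans hA⟩

/-- Colon by both ends of a leaf edge `xy`: a `(k+1)`-matching in `A` can be changed so as to use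
the edge `xy`, and this edge can then be removed. -/
theorem hasMatchingIn_leaf_iff [DecidableEq V] {W : Finset V} {x y : V} (hx : x ∈ W) (hy : y ∈ W)
    (hxy : G.Adj x y) (hleaf : ∀ w ∈ W, G.Adj x w → w = y) (k : ℕ) (F : Finset V) :
    HasMatchingIn G (k + 1) (W ∩ insert x (insert y F)) ↔
      HasMatchingIn G k ((W.erase x).erase y ∩ F) := by
  classical
  constructor
  · rintro ⟨M, hM, hk, hA⟩
    have h1 : (M.filter (y ∈ ·)).card ≤ 1 := Finset.card_le_one.2 fun e he e' he' =>
      hM.eq_of_mem (Finset.mem_filter.1 he).1 (Finset.mem_filter.1 he').1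
        (Finset.mem_filter.1 he).2 (Finset.mem_filter.1 he').2
    have h2 := Finset.card_filter_add_card_filter_not (s := M) (y ∈ ·)
    refine (hM.subset (Finset.filter_subset (y ∉ ·) M)).hasMatchingIn (by omega) ?_
    intro v hv
    obtain ⟨e, he, hve⟩ := mem_matchingVerts.1 hv
    obtain ⟨he, hye⟩ := Finset.mem_filter.1 he
    have hvA := hA (mem_matchingVerts.2 ⟨e, he, hve⟩)
    have hvy : v ≠ y := by rintro rfl; exact hye hve
    have hvx : v ≠ x := by
      rintro rfl
      obtain ⟨w, rfl, hvw, hw⟩ := hM.exists_adj he hve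
      exact hye (by simp [hleaf w (Finset.mem_inter.1 (hA hw)).1 hvw])
    simpa [hvy, hvx] using hvA
  · rintro ⟨M, hM, hk, hA⟩
    obtain ⟨h1, h2⟩ := hM.insert hxy (fun h => by simpa using hA h) (fun h => by simpa using hA h)
    refine ⟨_, h1, h2.trans (by rw [hk]), ?_⟩
    rw [matchingVerts_insert]
    intro v hv
    simp only [Finset.mem_insert] at hv
    rcases hv with rfl | rfl | hv
    · simp [hx]
    · simp [hy]
    · have := hA hv
      simp only [Finset.mem_inter, Finset.mem_erase] at this
      simp [this]

theorem hasMatchingIn_isolated_iff [DecidableEq V] {W : Finset V} {y : V}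
    (hiso : ∀ w ∈ W, ¬ G.Adj y w) (k : ℕ) (F : Finset V) :
    HasMatchingIn G k (W ∩ insert y F) ↔ HasMatchingIn G k (W.erase y ∩ F) := by
  constructor
  · rintro ⟨M, hM, hk, hA⟩
    refine ⟨M, hM, hk, fun v hv => ?_⟩
    have hvA := hA hv
    have hvy : v ≠ y := by
      rintro rfl
      obtain ⟨e, he, hve⟩ := mem_matchingVerts.1 hv
      obtain ⟨w, -, hvw, hw⟩ := hM.exists_adj he hve
      exact hiso w (Finset.mem_inter.1 (hA hw)).1 hvw
    simpa [hvy] using hvA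
  · refine fun h => HasMatchingIn.mono ?_ h
    intro v hv
    simp only [Finset.mem_inter, Finset.mem_erase] at hv
    simp [hv]

/-! ### Coloured admissible matchings -/

variable (G) in
/-- A matching in `W` together with a vertex colouring that is constant on the edges of the subgraph
induced on its vertices, such that `|M| ≤ #colours + k - 1`. The edges of each colour are the parts
of a `k`-admissible matching; in contrast to `IsAdmissibleMatching`, the empty matching is allowed
when `k ≥ 1`. -/
def IsColouredAdmissible (W : Finset V) (k : ℕ) (M : Finset (Sym2 V)) : Prop :=
  IsEdgeMatching G M ∧ matchingVerts M ⊆ W ∧ ∃ q : V → ℕ,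
    (∀ u ∈ matchingVerts M, ∀ v ∈ matchingVerts M, G.Adj u v → q u = q v) ∧
      M.card + 1 ≤ ((matchingVerts M).image q).card + k

theorem IsColouredAdmissible.mono {W W' : Finset V} (h : W ⊆ W') {k : ℕ} {M : Finset (Sym2 V)}
    (hM : IsColouredAdmissible G W k M) : IsColouredAdmissible G W' k M :=
  ⟨hM.1, hM.2.1.trans h, hM.2.2⟩

/-- An admissible matching avoiding a distant leaf edge `xy` can be enlarged by this edge. If `y`
has a neighbour on the matching, which can only be `z`, then `xy` takes the colour of `z` and `k` grows
by one; otherwise `xy` takes a new colour. -/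
theorem IsColouredAdmissible.exists_insert [DecidableEq V] {W : Finset V} {x y z : V}
    (hx : x ∈ W) (hy : y ∈ W) (hxy : G.Adj x y) (hleaf : ∀ w ∈ W, G.Adj x w → w = y)
    (hz : ∀ u ∈ W, G.Adj y u → (∀ w ∈ W, G.Adj u w → w = y) ∨ u = z)
    {W' : Finset V} (hW : W' ⊆ W) (hx' : x ∉ W') (hy' : y ∉ W') {k k' : ℕ} (hk : k' ≤ k)
    (hk' : (∃ u ∈ W', G.Adj y u) → k' + 1 ≤ k) {M : Finset (Sym2 V)}
    (hM : IsColouredAdmissible G W' k' M) :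
    ∃ N, IsColouredAdmissible G W k N ∧ N.card = M.card + 1 := by
  obtain ⟨hM, hMW, q, hq, hcard⟩ := hM
  have hxM : x ∉ matchingVerts M := fun h => hx' (hMW h)
  have hyM : y ∉ matchingVerts M := fun h => hy' (hMW h)
  obtain ⟨hN, hNcard⟩ := hM.insert hxy hxM hyM
  refine ⟨_, ⟨hN, ?_, ?_⟩, hNcard⟩
  · rw [matchingVerts_insert]
    exact Finset.insert_subset hx (Finset.insert_subset hy (hMW.trans hW))
  -- The neighbours of `y` on the matching are not leaves, so there is at most one.
  have hyz : ∀ u ∈ matchingVerts M, G.Adj y u → u = z := by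
    intro u hu hyu
    refine (hz u (hW (hMW hu)) hyu).resolve_left fun h => ?_
    obtain ⟨e, he, hue⟩ := mem_matchingVerts.1 hu
    obtain ⟨w, -, huw, hw⟩ := hM.exists_adj he hue
    exact hyM (h w (hW (hMW hw)) huw ▸ hw)
  obtain ⟨c, hc, hcount⟩ : ∃ c, (∀ u ∈ matchingVerts M, G.Adj y u → q u = c) ∧
      M.card + 2 ≤ (insert c ((matchingVerts M).image q)).card + k := by
    by_cases h : ∃ u ∈ matchingVerts M, G.Adj y u
    · obtain ⟨u, hu, hyu⟩ := h
      have := hk' ⟨u, hMW hu, hyu⟩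
      refine ⟨q u, fun u' hu' hyu' => by rw [hyz u hu hyu, hyz u' hu' hyu'], ?_⟩
      rw [Finset.insert_eq_of_mem (Finset.mem_image_of_mem q hu)]
      omega
    · obtain ⟨c, hc⟩ := Infinite.exists_notMem_finset ((matchingVerts M).image q)
      refine ⟨c, fun u hu hyu => absurd ⟨u, hu, hyu⟩ h, ?_⟩
      rw [Finset.card_insert_of_notMem hc]
      omega
  let q' : V → ℕ := fun v => if v = x ∨ v = y then c else q v
  have hqx : q' x = c := by simp [q']
  have hqy : q' y = c := by simp [q']
  have hqM : ∀ v ∈ matchingVerts M, q' v = q v := by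
    intro v hv
    have h1 : v ≠ x := by rintro rfl; exact hxM hv
    have h2 : v ≠ y := by rintro rfl; exact hyM hv
    simp [q', h1, h2]
  refine ⟨q', ?_, ?_⟩
  · have hxc : ∀ v ∈ matchingVerts M, G.Adj x v → q' v = c := fun v hv hxv =>
      absurd (hleaf v (hW (hMW hv)) hxv ▸ hv) hyM
    have hyc : ∀ v ∈ matchingVerts M, G.Adj y v → q' v = c := fun v hv hyv => by
      rw [hqM v hv, hc v hv hyv]
    intro u hu v hv huv
    rw [matchingVerts_insert, Finset.mem_insert, Finset.mem_insert] at hu hv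
    rcases hu with rfl | rfl | hu <;> rcases hv with rfl | rfl | hv
    · rfl
    · rw [hqx, hqy]
    · rw [hqx, hxc v hv huv]
    · rw [hqx, hqy]
    · rfl
    · rw [hqy, hyc v hv huv]
    · rw [hqx, hxc u hu huv.symm]
    · rw [hqy, hyc u hu huv.symm]
    · rw [hqM u hu, hqM v hv, hq u hu v hv huv]
  · rw [matchingVerts_insert, Finset.image_insert, Finset.image_insert, hqx, hqy,
      Finset.insert_idem, Finset.image_congr hqM, hNcard]
    exact hcount

end Matchings

/-! ### The upper bound for the regularity -/

section UpperBound

variable (K : Type*) [Field K] {V : Type*} [Fintype V] [LinearOrder V] {G : SimpleGraph V}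

/-- If the coloured `k`-admissible matchings in `W` have size at most `n`, then the `k`-th
squarefree power of the edge ideal of the forest induced on `W` has regularity at most `n + k`. -/
theorem SimpleGraph.IsAcyclic.regLE_hasMatchingIn (hG : G.IsAcyclic) (W : Finset V) :
    ∀ k n : ℕ, (∀ M, IsColouredAdmissible G W k M → M.card ≤ n) →
      RegLE K (fun F => HasMatchingIn G k (W ∩ F)) (n + k) := by
  induction W using Finset.strongInduction with
  | H W ih =>
  intro k n hn
  rcases k with _ | k
  · have htriv : (fun F => HasMatchingIn G 0 (W ∩ F)) = fun _ => True := by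
      funext F
      refine eq_true ⟨∅, ⟨by simp, by simp⟩, rfl, ?_⟩
      simp [matchingVerts]
    rw [htriv]
    exact regLE_true.mono (Nat.zero_le _)
  by_cases hedge : ∃ a ∈ W, ∃ b ∈ W, G.Adj a b
  swap
  · refine regLE_of_forall_not ?_ _
    rintro F ⟨M, hM, hk, hA⟩
    obtain ⟨e, he⟩ := Finset.card_pos.1 (by omega : 0 < M.card)
    obtain ⟨v, hv⟩ : ∃ v, v ∈ e := e.ind fun a b => ⟨a, by simp⟩
    obtain ⟨w, -, hvw, hw⟩ := hM.exists_adj he hv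
    exact hedge ⟨v, (Finset.mem_inter.1 (hA (mem_matchingVerts.2 ⟨e, he, hv⟩))).1, w,
      (Finset.mem_inter.1 (hA hw)).1, hvw⟩
  obtain ⟨a, ha, b, hb, hab⟩ := hedge
  obtain ⟨x, hx, y, hy, z, hxy, hleaf, hz⟩ := hG.exists_distant_leaf_of_mem hab ha hb
  have hmono : ∀ (U : Finset V) (k : ℕ), Monotone fun F => HasMatchingIn G k (U ∩ F) :=
    fun U k A B h => HasMatchingIn.mono (Finset.inter_subset_inter_left h)
  have hmono' : ∀ (U : Finset V) (k : ℕ), Monotone fun F => HasMatchingIn G k (U ∩ insert y F) :=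
    fun U k A B h => hmono U k (Finset.insert_subset_insert y h)
  -- The edge `xy` alone is admissible, so `n ≥ 1`.
  obtain ⟨n, rfl⟩ : ∃ n', n = n' + 1 := by
    have hempty : IsColouredAdmissible G ∅ (k + 1) ∅ :=
      ⟨⟨by simp, by simp⟩, by simp [matchingVerts], fun _ => 0, by simp [matchingVerts],
        by rw [Finset.card_empty]; omega⟩
    obtain ⟨N, hN, hNc⟩ := hempty.exists_insert hx hy hxy hleaf hz (Finset.empty_subset W)
      (by simp) (by simp) le_rfl (by simp)
    have := hn N hN
    exact ⟨n - 1, by omega⟩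
  -- The induction hypothesis for the sets that avoid `y` and one of its leaves.
  have hA : ∀ u ∈ W, G.Adj u y → (∀ w ∈ W, G.Adj u w → w = y) → ∀ W' ⊆ W, u ∉ W' → y ∉ W' →
      RegLE K (fun F => HasMatchingIn G k (W' ∩ F)) (n + k) := by
    intro u hu huy hul W' hW hu' hy'
    refine ih W' ((Finset.ssubset_iff_of_subset hW).2 ⟨y, hy, hy'⟩) k n fun M hM => ?_
    obtain ⟨N, hN, hNc⟩ := hM.exists_insert hu hy huy hul hz hW hu' hy' (Nat.le_succ k)
      fun _ => le_rfl
    have := hn N hN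
    omega
  -- The induction hypothesis for the sets in which, moreover, `y` has no neighbour: here `xy` takes
  -- a new colour, so `k + 1` need not be lowered.
  have hB : ∀ W' ⊆ W, x ∉ W' → y ∉ W' → (∀ u ∈ W', ¬ G.Adj y u) →
      RegLE K (fun F => HasMatchingIn G (k + 1) (W' ∩ F)) (n + k + 1) := by
    intro W' hW hx' hy' hiso
    refine ih W' ((Finset.ssubset_iff_of_subset hW).2 ⟨y, hy, hy'⟩) (k + 1) n fun M hM => ?_
    obtain ⟨N, hN, hNc⟩ := hM.exists_insert hx hy hxy hleaf hz hW hx' hy' le_rfl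
      fun ⟨u, hu, hyu⟩ => absurd hyu (hiso u hu)
    have := hn N hN
    omega
  classical
  let L := W.filter fun u => G.Adj u y ∧ ∀ w ∈ W, G.Adj u w → w = y
  have hxL : x ∈ L := Finset.mem_filter.2 ⟨hx, hxy, hleaf⟩
  have hyL : y ∉ L := fun h => G.irrefl (Finset.mem_filter.1 h).2.1
  -- The colon by `y`, after deletion of the leaves at `y` outside `T`; the leaves in `T` are
  -- removed one by one.
  have hcol : ∀ T ⊆ L,
      RegLE K (fun F => HasMatchingIn G (k + 1) ((W \ (L \ T)) ∩ insert y F)) (n + k + 1) := by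
    intro T
    induction T using Finset.induction_on with
    | empty =>
      intro _
      rw [Finset.sdiff_empty]
      have hyW : y ∈ W \ L := Finset.mem_sdiff.2 ⟨hy, hyL⟩
      have hnbr : ∀ w ∈ W \ L, G.Adj y w → w = z := fun w hw hyw =>
        (hz w (Finset.mem_sdiff.1 hw).1 hyw).resolve_left fun h =>
          (Finset.mem_sdiff.1 hw).2 (Finset.mem_filter.2 ⟨(Finset.mem_sdiff.1 hw).1, hyw.symm, h⟩)
      -- Without its leaves, `y` is either a leaf itself, with neighbour `z`, or isolated.
      by_cases hzW : z ∈ W \ L ∧ G.Adj y z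
      · obtain ⟨hzW, hyz⟩ := hzW
        refine RegLE.of_colon_of_delete (hmono' _ _) z ?_ ?_
        · simp only [Finset.insert_comm y z]
          have := fun F => hasMatchingIn_leaf_iff hyW hzW hyz hnbr k F
          simp only [Finset.insert_comm y z] at this
          simp only [this]
          refine hA x hx hxy hleaf _ ?_ ?_ ?_
          · exact (Finset.erase_subset _ _).trans
              ((Finset.erase_subset _ _).trans Finset.sdiff_subset)
          · simp [hxL]
          · simp
        · have hset : ∀ F, (W \ L) ∩ insert y (F.erase z) = ((W \ L).erase z) ∩ insert y F := by
            intro F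
            ext v
            by_cases h : v = z
            · simp [h, hyz.ne.symm]
            · simp [h]
          have hiso : ∀ w ∈ (W \ L).erase z, ¬ G.Adj y w := fun w hw hyw =>
            (Finset.mem_erase.1 hw).1 (hnbr w (Finset.mem_erase.1 hw).2 hyw)
          simp only [hset, hasMatchingIn_isolated_iff hiso]
          refine hB _ ?_ ?_ ?_ ?_
          · exact (Finset.erase_subset _ _).trans
              ((Finset.erase_subset _ _).trans Finset.sdiff_subset)
          · simp [hxL]
          · simp
          · exact fun u hu => hiso u (Finset.mem_of_mem_erase hu)
      · have hiso : ∀ w ∈ W \ L, ¬ G.Adj y w := by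
          intro w hw hyw
          have := hnbr w hw hyw
          subst this
          exact hzW ⟨hw, hyw⟩
        simp only [hasMatchingIn_isolated_iff hiso]
        refine hB _ ?_ ?_ ?_ ?_
        · exact (Finset.erase_subset _ _).trans Finset.sdiff_subset
        · simp [hxL]
        · simp
        · exact fun u hu => hiso u (Finset.mem_of_mem_erase hu)
    | insert u T hu ihT =>
      intro hT
      have huL : u ∈ L := hT (Finset.mem_insert_self u T)
      obtain ⟨huW, huy, hul⟩ := Finset.mem_filter.1 huL
      have hW' : W \ (L \ insert u T) ⊆ W := Finset.sdiff_subset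
      refine RegLE.of_colon_of_delete (hmono' _ _) u ?_ ?_
      · have h1 : u ∈ W \ (L \ insert u T) := by simp [huW]
        have h2 : y ∈ W \ (L \ insert u T) := by simp [hy, hyL]
        have := fun F => hasMatchingIn_leaf_iff h1 h2 huy (fun w hw => hul w (hW' hw)) k F
        simp only [Finset.insert_comm u y] at this
        simp only [this]
        refine hA u huW huy hul _ ?_ ?_ ?_
        · exact (Finset.erase_subset _ _).trans ((Finset.erase_subset _ _).trans hW')
        · simp
        · simp
      · have hset : ∀ F, (W \ (L \ insert u T)) ∩ insert y (F.erase u) =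
            (W \ (L \ T)) ∩ insert y F := by
          intro F
          ext v
          by_cases h : v = u
          · simp [h, huy.ne, huL, hu]
          · simp [h]
        simp only [hset]
        exact ihT ((Finset.subset_insert u T).trans hT)
  rw [show n + 1 + (k + 1) = n + k + 1 + 1 by omega]
  refine RegLE.of_colon_of_delete (hmono _ _) y ?_ ?_
  · simpa using hcol L subset_rfl
  · have hset : ∀ F, W ∩ F.erase y = W.erase y ∩ F := by
      intro F
      ext v
      simp only [Finset.mem_inter, Finset.mem_erase]
      tauto
    simp only [hset]
    have := ih (W.erase y) (Finset.erase_ssubset hy) (k + 1) (n + 1) fun M hM =>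
      hn M (hM.mono (Finset.erase_subset _ _))
    exact this.mono (by omega)

end UpperBound

/-! ### A nonzero class in Koszul homology -/

section Transversals

/-- The inversion sign `(-1)^#{(u, v) ∈ A × A : u < v, q v < q u}` of a colouring `q` on `A`. -/
noncomputable def inversionSign (K : Type*) [Field K] {V : Type*} [LinearOrder V] (q : V → ℕ)
    (A : Finset V) : K :=
  ∏ u ∈ A, ∏ v ∈ A, if u < v ∧ q v < q u then -1 else 1

variable {K : Type*} [Field K] {V : Type*} {q : V → ℕ}

variable (q) in
/-- The subsets of `W` that contain exactly one vertex of each of the colours `1, …, t` and no other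
vertex. -/
def transversals (W : Finset V) (t : ℕ) : Finset (Finset V) :=
  W.powerset.filter fun F => F.card = t ∧ F.image q = (Finset.range (t + 1)).erase 0

theorem mem_transversals {W F : Finset V} {t : ℕ} : F ∈ transversals q W t ↔
    F ⊆ W ∧ F.card = t ∧ F.image q = (Finset.range (t + 1)).erase 0 := by
  simp [transversals]

theorem injOn_of_mem_transversals {W F : Finset V} {t : ℕ} (hF : F ∈ transversals q W t) :
    Set.InjOn q F := by
  obtain ⟨-, h1, h2⟩ := mem_transversals.1 hF
  refine Finset.card_image_iff.1 ?_
  rw [h2, h1]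
  simp

variable [LinearOrder V]

theorem inversionSign_ne_zero (A : Finset V) : inversionSign K q A ≠ 0 := by
  refine Finset.prod_ne_zero_iff.2 fun u _ => Finset.prod_ne_zero_iff.2 fun v _ => ?_
  split_ifs <;> simp

theorem inversionSign_insert {u : V} {A : Finset V} (hu : u ∉ A) :
    inversionSign K q (insert u A) = inversionSign K q A *
      ∏ w ∈ A, ((if u < w ∧ q w < q u then -1 else 1) * if w < u ∧ q u < q w then -1 else 1) := by
  simp only [inversionSign, Finset.prod_insert hu, Finset.prod_mul_distrib]
  simp only [lt_irrefl, false_and, if_false, one_mul]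
  ring

theorem neg_one_pow_card_filter_lt (v : V) (A : Finset V) :
    (-1 : K) ^ (A.filter (· < v)).card = ∏ w ∈ A, if w < v then -1 else 1 := by
  rw [Finset.prod_ite, Finset.prod_const, Finset.prod_const_one, mul_one]

/-- If `u` and `v` have the same colour, which does not occur in `A`, then the two faces of
`A ∪ {u, v}` obtained by removing `v` or `u` enter with opposite signs. -/
theorem inversionSign_insert_add {u v : V} {A : Finset V} (huv : u ≠ v) (hu : u ∉ A) (hv : v ∉ A)
    (hq : q u = q v) (hA : ∀ w ∈ A, q w ≠ q u) :
    inversionSign K q (insert u A) * (-1) ^ ((insert u A).filter (· < v)).card +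
      inversionSign K q (insert v A) * (-1) ^ ((insert v A).filter (· < u)).card = 0 := by
  wlog h : u < v generalizing u v
  · rw [add_comm]
    exact this huv.symm hv hu hq.symm (fun w hw => hq ▸ hA w hw)
      (lt_of_le_of_ne (not_lt.1 h) huv.symm)
  rw [neg_one_pow_card_filter_lt, neg_one_pow_card_filter_lt, Finset.prod_insert hu,
    Finset.prod_insert hv, if_pos h, if_neg h.not_gt, inversionSign_insert hu,
    inversionSign_insert hv]
  have key : (∏ w ∈ A, (((if u < w ∧ q w < q u then (-1 : K) else 1) *
        if w < u ∧ q u < q w then -1 else 1) * if w < v then -1 else 1)) =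
      ∏ w ∈ A, (((if v < w ∧ q w < q v then (-1 : K) else 1) *
        if w < v ∧ q v < q w then -1 else 1) * if w < u then -1 else 1) := by
    refine Finset.prod_congr rfl fun w hw => ?_
    have hwu : w ≠ u := by rintro rfl; exact hu hw
    have hwv : w ≠ v := by rintro rfl; exact hv hw
    rw [← hq]
    rcases lt_or_gt_of_ne (hA w hw) with h1 | h1 <;>
    rcases lt_or_gt_of_ne hwu with h2 | h2 <;>
    rcases lt_or_gt_of_ne hwv with h3 | h3 <;>
    simp [h1, h2, h3, h1.not_gt, h2.not_gt, h3.not_gt]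
  rw [Finset.prod_mul_distrib] at key
  conv_rhs at key => rw [Finset.prod_mul_distrib]
  linear_combination (-inversionSign K q A) * key

variable (K q) in
/-- The value at `∂ e_H` of the cochain that takes the value `inversionSign K q F` at each
transversal `F`. -/
noncomputable def transversalCoboundary (W : Finset V) (t : ℕ) (H : Finset V) : K :=
  ∑ v ∈ H.filter fun v => H.erase v ∈ transversals q W t,
    inversionSign K q (H.erase v) * (-1) ^ ((H.erase v).filter (· < v)).card

theorem transversalCoboundary_eq_zero {W H : Finset V} {t : ℕ} (hH : H ⊆ W)
    (hW : ∀ v ∈ W, q v ≤ t) (hmiss : ¬ Finset.range (t + 1) ⊆ H.image q) :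
    transversalCoboundary K q W t H = 0 := by
  by_cases hex : ∃ v ∈ H, H.erase v ∈ transversals q W t
  swap
  · rw [transversalCoboundary, Finset.filter_eq_empty_iff.2 fun v hv h => hex ⟨v, hv, h⟩,
      Finset.sum_empty]
  obtain ⟨v, hv, hF⟩ := hex
  obtain ⟨hFW, hFc, hFq⟩ := mem_transversals.1 hF
  have hinj := injOn_of_mem_transversals hF
  have hqv : q v ∈ (H.erase v).image q := by
    rw [hFq, Finset.mem_erase, Finset.mem_range]
    refine ⟨fun h0 => hmiss fun j hj => ?_, Nat.lt_succ_of_le (hW v (hH hv))⟩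
    by_cases hj0 : j = 0
    · exact Finset.mem_image.2 ⟨v, hv, by omega⟩
    · have : j ∈ (H.erase v).image q := by
        rw [hFq]
        exact Finset.mem_erase.2 ⟨hj0, hj⟩
      exact Finset.image_subset_image (Finset.erase_subset v H) this
  obtain ⟨u, hu, hquv⟩ := Finset.mem_image.1 hqv
  obtain ⟨A, huA, hA⟩ : ∃ A, u ∉ A ∧ insert u A = H.erase v :=
    ⟨_, Finset.notMem_erase u _, Finset.insert_erase hu⟩
  have huv : u ≠ v := (Finset.mem_erase.1 hu).1
  have hvA : v ∉ A := fun h => Finset.notMem_erase v H (hA ▸ Finset.mem_insert_of_mem h)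
  have hHA : H = insert v (insert u A) := by rw [hA, Finset.insert_erase hv]
  have hHu : H.erase u = insert v A := by
    rw [hHA, Finset.insert_comm, Finset.erase_insert]
    simp [huv, huA]
  have hHuT : H.erase u ∈ transversals q W t := by
    refine mem_transversals.2 ⟨(Finset.erase_subset u H).trans hH, ?_, ?_⟩
    · rw [Finset.card_erase_of_mem (Finset.mem_erase.1 hu).2, ← Finset.card_erase_of_mem hv, hFc]
    · rw [← hFq, hHu, ← hA, Finset.image_insert, Finset.image_insert, hquv]
  have hfilter : (H.filter fun v => H.erase v ∈ transversals q W t) = {v, u} := by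
    ext w
    simp only [Finset.mem_filter, Finset.mem_insert, Finset.mem_singleton]
    constructor
    · rintro ⟨hw, hwT⟩
      by_contra hne
      push Not at hne
      exact huv (injOn_of_mem_transversals hwT
        (Finset.mem_coe.2 (Finset.mem_erase.2 ⟨hne.2.symm, (Finset.mem_erase.1 hu).2⟩))
        (Finset.mem_coe.2 (Finset.mem_erase.2 ⟨hne.1.symm, hv⟩)) hquv)
    · rintro (rfl | rfl)
      · exact ⟨hv, hF⟩
      · exact ⟨(Finset.mem_erase.1 hu).2, hHuT⟩
  rw [transversalCoboundary, hfilter, Finset.sum_pair huv.symm, hHu, ← hA]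
  refine inversionSign_insert_add huv huA hvA hquv fun w hw hqw => huA ?_
  have : w = u := hinj (by rw [← hA]; simp [hw]) (by rw [← hA]; simp) hqw
  exact this ▸ hw

theorem transversalCoboundary_ne_zero {W X : Finset V} {t : ℕ} (hX : X ⊆ W)
    (hXc : X.card = t + 1) (hXq : X.image q = Finset.range (t + 1)) :
    transversalCoboundary K q W t X ≠ 0 := by
  have hinj : Set.InjOn q X := Finset.card_image_iff.1 (by rw [hXq, hXc, Finset.card_range])
  obtain ⟨x, hx, hx0⟩ := Finset.mem_image.1 (hXq ▸ Finset.mem_range.2 (Nat.succ_pos t))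
  have himage : ∀ v ∈ X, (X.erase v).image q = (Finset.range (t + 1)).erase (q v) := by
    intro v hv
    rw [← hXq]
    ext j
    simp only [Finset.mem_image, Finset.mem_erase]
    constructor
    · rintro ⟨w, ⟨hwv, hw⟩, rfl⟩
      exact ⟨fun h => hwv (hinj hw hv h), w, hw, rfl⟩
    · rintro ⟨hj, w, hw, rfl⟩
      exact ⟨w, ⟨fun h => hj (h ▸ rfl), hw⟩, rfl⟩
  have hfilter : (X.filter fun v => X.erase v ∈ transversals q W t) = {x} := by
    ext v
    simp only [Finset.mem_filter, Finset.mem_singleton, mem_transversals]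
    constructor
    · rintro ⟨hv, -, -, h⟩
      rw [himage v hv] at h
      by_contra hne
      have hv0 : q v ≠ 0 := fun h0 => hne (hinj hv hx (by rw [h0, hx0]))
      have : 0 ∈ (Finset.range (t + 1)).erase (q v) := by simp [hv0.symm]
      rw [h] at this
      simp at this
    · rintro rfl
      refine ⟨hx, (Finset.erase_subset _ _).trans hX, ?_, ?_⟩
      · rw [Finset.card_erase_of_mem hx, hXc, Nat.add_sub_cancel]
      · rw [himage _ hx, hx0]
  rw [transversalCoboundary, hfilter, Finset.sum_singleton]
  exact mul_ne_zero (inversionSign_ne_zero _) (pow_ne_zero _ (by simp))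

end Transversals

/-- The exponent vector of the squarefree monomial `∏_{v ∈ A} x_v`. -/
noncomputable def squarefreeExponent {V : Type*} (A : Finset V) : V →₀ ℕ :=
  ∑ v ∈ A, Finsupp.single v 1

section SquarefreeExponent

variable {V : Type*}

theorem squarefreeExponent_apply [DecidableEq V] (A : Finset V) (v : V) :
    squarefreeExponent A v = if v ∈ A then 1 else 0 := by
  simp [squarefreeExponent, Finsupp.finsetSum_apply, Finsupp.single_apply]

theorem support_squarefreeExponent (A : Finset V) : (squarefreeExponent A).support = A := by
  classical
  ext v
  simp [squarefreeExponent_apply]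

theorem degree_squarefreeExponent (A : Finset V) : (squarefreeExponent A).degree = A.card := by
  simp [squarefreeExponent, map_sum, Finsupp.degree_single]

theorem squarefreeExponent_sub_single [DecidableEq V] {A : Finset V} {v : V} (hv : v ∈ A) :
    squarefreeExponent A - Finsupp.single v 1 = squarefreeExponent (A.erase v) := by
  rw [squarefreeExponent, ← Finset.add_sum_erase _ _ hv, add_tsub_cancel_left, squarefreeExponent]

theorem squarefreeExponent_le_iff {A : Finset V} {m : V →₀ ℕ} :
    squarefreeExponent A ≤ m ↔ A ⊆ m.support := by
  classical
  simp only [Finsupp.le_def, squarefreeExponent_apply]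
  constructor
  · intro h v hv
    have := h v
    rw [if_pos hv] at this
    exact Finsupp.mem_support_iff.2 (by omega)
  · intro h v
    split_ifs with hv
    · exact Nat.one_le_iff_ne_zero.2 (Finsupp.mem_support_iff.1 (h hv))
    · exact Nat.zero_le _

end SquarefreeExponent

section NonBoundary

variable {K : Type*} [Field K] {V : Type*} [Fintype V] [LinearOrder V] {q : V → ℕ}

/-- The functional of a colouring on the Koszul chains of multidegree `W`, evaluated at a
boundary. -/
theorem sum_transversals_koszulDifferential (W : Finset V) (t : ℕ)
    (b : Finset V → MvPolynomial V K) :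
    ∑ F ∈ transversals q W t, inversionSign K q F *
        coeff (squarefreeExponent (W \ F)) (koszulDifferential K V b F) =
      ∑ H ∈ W.powerset, coeff (squarefreeExponent (W \ H)) (b H) *
        transversalCoboundary K q W t H := by
  have h1 : ∀ F, coeff (squarefreeExponent (W \ F)) (koszulDifferential K V b F) =
      ∑ v ∈ W \ F, (-1) ^ (F.filter (· < v)).card *
        coeff (squarefreeExponent (W \ insert v F)) (b (insert v F)) := by
    intro F
    rw [coeff_koszulDifferential, support_squarefreeExponent]
    refine (Finset.sum_subset (Finset.sdiff_subset_sdiff (Finset.subset_univ W) subset_rfl)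
      fun v _ hv => by rw [if_neg hv, mul_zero]).symm.trans (Finset.sum_congr rfl fun v hv => ?_)
    rw [if_pos hv, squarefreeExponent_sub_single hv, Finset.sdiff_insert]
  simp only [h1, transversalCoboundary, Finset.mul_sum]
  rw [Finset.sum_sigma', Finset.sum_sigma']
  refine Finset.sum_bij' (fun p _ => ⟨insert p.2 p.1, p.2⟩) (fun p _ => ⟨p.1.erase p.2, p.2⟩)
    ?_ ?_ ?_ ?_ ?_
  · rintro ⟨F, v⟩ h
    simp only [Finset.mem_sigma, Finset.mem_sdiff] at h
    simp only [Finset.mem_sigma, Finset.mem_powerset, Finset.mem_filter,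
      Finset.mem_insert_self, true_and, Finset.erase_insert h.2.2]
    exact ⟨Finset.insert_subset h.2.1 (mem_transversals.1 h.1).1, h.1⟩
  · rintro ⟨H, v⟩ h
    simp only [Finset.mem_sigma, Finset.mem_powerset, Finset.mem_filter] at h
    simp only [Finset.mem_sigma, Finset.mem_sdiff, Finset.notMem_erase, not_false_eq_true, and_true]
    exact ⟨h.2.2, h.1 h.2.1⟩
  · rintro ⟨F, v⟩ h
    simp only [Finset.mem_sigma, Finset.mem_sdiff] at h
    simp [Finset.erase_insert h.2.2]
  · rintro ⟨H, v⟩ h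
    simp only [Finset.mem_sigma, Finset.mem_powerset, Finset.mem_filter] at h
    simp [Finset.insert_erase h.2.1]
  · rintro ⟨F, v⟩ h
    simp only [Finset.mem_sigma, Finset.mem_sdiff] at h
    simp only [Finset.erase_insert h.2.2]
    ring

/-- Suppose that the vertices of `W` have the colours `0, …, t`, that `X ⊆ W` contains one vertex of
each colour, that `x^(W \ Y) ∈ I` for every proper subset `Y` of `X`, and that `x^(W \ F) ∉ I`
whenever `F` meets all colours. Then `∂ (x^(W \ X) e_X)` is a cycle of `I` that is not a boundary.
The simplices `F ⊆ W` with `x^(W \ F) ∈ I` form a complex that the colouring retracts onto the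
boundary of the simplex `X`; the functional below is the fundamental cocycle of that sphere. -/
theorem exists_cycle_not_boundary {P : Finset V → Prop} {W X : Finset V} {t : ℕ}
    (hW : ∀ v ∈ W, q v ≤ t) (hX : X ⊆ W) (hXc : X.card = t + 1)
    (hXq : X.image q = Finset.range (t + 1)) (hface : ∀ v ∈ X, P (W \ X.erase v))
    (hmiss : ∀ F ⊆ W, P (W \ F) → ¬ Finset.range (t + 1) ⊆ F.image q) :
    ∃ c ∈ supportChains K P t W.card, koszulDifferential K V c = 0 ∧
      ∀ b ∈ supportChains K P (t + 1) W.card, koszulDifferential K V b ≠ c := by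
  let b₀ : Finset V → MvPolynomial V K :=
    Pi.single X (monomial (squarefreeExponent (W \ X)) 1)
  have hb₀ : ∀ F m, coeff m (b₀ F) ≠ 0 → F = X ∧ m = squarefreeExponent (W \ X) := by
    intro F m hm
    by_cases hF : F = X
    · subst hF
      simp only [b₀, Pi.single_eq_same, coeff_monomial] at hm
      exact ⟨rfl, by_contra fun h => hm (if_neg (Ne.symm h))⟩
    · simp [b₀, Pi.single_eq_of_ne hF] at hm
  refine ⟨koszulDifferential K V b₀, ?_, koszulDifferential_comp_self K V b₀, ?_⟩
  · intro F m hm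
    obtain ⟨v, m', hv, rfl, h⟩ := exists_of_coeff_koszulDifferential_ne_zero hm
    obtain ⟨hF, rfl⟩ := hb₀ _ _ h
    have hvX : v ∈ X := hF ▸ Finset.mem_insert_self v F
    have hFX : F = X.erase v := by rw [← hF, Finset.erase_insert hv]
    have hWX := Finset.card_sdiff_add_card_eq_card hX
    have hFc : F.card = t := by rw [hFX, Finset.card_erase_of_mem hvX, hXc, Nat.add_sub_cancel]
    refine ⟨?_, hFc, ?_⟩
    · rw [support_add_single, support_squarefreeExponent, ← Finset.sdiff_erase (hX hvX)]
      exact hface v hvX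
    · rw [map_add, degree_squarefreeExponent, Finsupp.degree_single]
      omega
  · intro b hb heq
    have h := sum_transversals_koszulDifferential (q := q) W t b
    rw [heq, sum_transversals_koszulDifferential, Finset.sum_eq_single_of_mem X
      (Finset.mem_powerset.2 hX)] at h
    · have hcoeff : coeff (squarefreeExponent (W \ X)) (b₀ X) = 1 := by
        simp [b₀]
      rw [hcoeff, one_mul] at h
      refine transversalCoboundary_ne_zero hX hXc hXq (h.trans (Finset.sum_eq_zero fun H hH => ?_))
      rw [Finset.mem_powerset] at hH
      by_cases hbH : coeff (squarefreeExponent (W \ H)) (b H) = 0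
      · rw [hbH, zero_mul]
      · have hP := (hb _ _ hbH).1
        rw [support_squarefreeExponent] at hP
        rw [transversalCoboundary_eq_zero hH hW (hmiss H hH hP), mul_zero]
    · intro H _ hHX
      simp [b₀, Pi.single_eq_of_ne hHX]

end NonBoundary

/-! ### Admissible matchings and colourings -/

section Admissible

variable {V : Type*} [Fintype V] {G : SimpleGraph V}

theorem IsGap.not_adj {e e' : Sym2 V} (h : IsGap G e e') {u v : V} (hu : u ∈ e) (hv : v ∈ e') :
    ¬ G.Adj u v := by
  classical
  intro huv
  obtain ⟨hne, hM, hind⟩ := h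
  have hmem : s(u, v) ∈ ((⊤ : G.Subgraph).induce
      (matchingVerts {e, e'} : Set V)).edgeSet := by
    rw [SimpleGraph.Subgraph.mem_edgeSet, SimpleGraph.Subgraph.induce_adj]
    exact ⟨mem_matchingVerts.2 ⟨e, by simp, hu⟩, mem_matchingVerts.2 ⟨e', by simp, hv⟩, huv⟩
  rw [hind] at hmem
  have hmem : s(u, v) = e ∨ s(u, v) = e' := by simpa using hmem
  rcases hmem with h | h
  · exact hne (hM.eq_of_mem (by simp) (by simp) (h ▸ Sym2.mem_mk_right u v : v ∈ e) hv)
  · exact hne (hM.eq_of_mem (by simp) (by simp) hu (h ▸ Sym2.mem_mk_left u v : u ∈ e'))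

theorem IsEdgeMatching.isGap {M : Finset (Sym2 V)} (hM : IsEdgeMatching G M) {e e' : Sym2 V}
    (he : e ∈ M) (he' : e' ∈ M) (hne : e ≠ e') (hadj : ∀ u ∈ e, ∀ v ∈ e', ¬ G.Adj u v) :
    IsGap G e e' := by
  classical
  have hsub : ∀ f ∈ ({e, e'} : Finset (Sym2 V)), f ∈ M := by simp [he, he']
  have hpair : IsEdgeMatching G {e, e'} := hM.subset hsub
  have hedge : ∀ f ∈ M, ∀ a ∈ f, ∀ b ∈ f, G.Adj a b → s(a, b) = f := by
    intro f hf a ha b hb hab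
    exact ((Sym2.mem_and_mem_iff hab.ne).1 ⟨ha, hb⟩).symm
  refine ⟨hne, by convert hpair, ?_⟩
  ext f
  induction f with
  | h a b =>
  rw [SimpleGraph.Subgraph.mem_edgeSet, SimpleGraph.Subgraph.induce_adj]
  have hcoe : s(a, b) ∈ (({e, e'} : Finset (Sym2 V)) : Set (Sym2 V)) ↔
      s(a, b) = e ∨ s(a, b) = e' := by simp
  have hverts : ∀ c, c ∈ matchingVerts ({e, e'} : Finset (Sym2 V)) ↔ c ∈ e ∨ c ∈ e' := by
    intro c
    simp [mem_matchingVerts]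
  constructor
  · rintro ⟨ha, hb, hab⟩
    have hab' : G.Adj a b := hab
    have ha : a ∈ e ∨ a ∈ e' := by
      refine (hverts a).1 ?_
      convert Finset.mem_coe.1 ha
    have hb : b ∈ e ∨ b ∈ e' := by
      refine (hverts b).1 ?_
      convert Finset.mem_coe.1 hb
    have : s(a, b) = e ∨ s(a, b) = e' := by
      rcases ha with ha | ha <;> rcases hb with hb | hb
      · exact Or.inl (hedge e he a ha b hb hab')
      · exact absurd hab' (hadj a ha b hb)
      · exact absurd hab'.symm (hadj b hb a ha)
      · exact Or.inr (hedge e' he' a ha b hb hab')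
    convert hcoe.2 this
  · intro h
    have h : s(a, b) = e ∨ s(a, b) = e' := by
      refine hcoe.1 ?_
      convert h
    have hab : G.Adj a b := by
      rcases h with h | h
      · exact hM.1 _ (h ▸ he : s(a, b) ∈ M)
      · exact hM.1 _ (h ▸ he' : s(a, b) ∈ M)
    have ha := (hverts a).2 (h.imp (fun h : s(a, b) = e => h ▸ Sym2.mem_mk_left a b)
      (fun h : s(a, b) = e' => h ▸ Sym2.mem_mk_left a b))
    have hb := (hverts b).2 (h.imp (fun h : s(a, b) = e => h ▸ Sym2.mem_mk_right a b)
      (fun h : s(a, b) = e' => h ▸ Sym2.mem_mk_right a b))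
    refine ⟨Finset.mem_coe.2 ?_, Finset.mem_coe.2 ?_, hab⟩
    · convert ha
    · convert hb

/-- The colour of a representative endpoint of an edge, used as the colour of the edge, is the
colour of both endpoints. -/
theorem IsEdgeMatching.apply_out_eq {M : Finset (Sym2 V)} (hM : IsEdgeMatching G M) {q : V → ℕ}
    (hq : ∀ u ∈ matchingVerts M, ∀ v ∈ matchingVerts M, G.Adj u v → q u = q v) {e : Sym2 V}
    (he : e ∈ M) {v : V} (hv : v ∈ e) : q e.out.1 = q v := by
  obtain ⟨w, rfl, hvw, hw⟩ := hM.exists_adj he hv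
  have hv' : v ∈ matchingVerts M := mem_matchingVerts.2 ⟨_, he, hv⟩
  rcases Sym2.mem_iff.1 (Sym2.out_fst_mem s(v, w)) with h | h
  · rw [h]
  · rw [h, hq v hv' w hw hvw]

theorem bddAbove_card_isAdmissibleMatching (G : SimpleGraph V) (k : ℕ) :
    BddAbove {m : ℕ | ∃ M : Finset (Sym2 V), IsAdmissibleMatching G k M ∧ M.card = m} := by
  classical
  refine ⟨Fintype.card (Sym2 V), ?_⟩
  rintro m ⟨M, -, rfl⟩
  exact M.card_le_univ

/-- The colour classes of a coloured admissible matching are the parts of an admissible matching. -/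
theorem IsColouredAdmissible.card_le_aim (hG : G.IsAcyclic) {W : Finset V} {k : ℕ}
    {M : Finset (Sym2 V)} (h : IsColouredAdmissible G W k M) : M.card ≤ aim G k := by
  classical
  obtain ⟨hM, -, q, hq, hcard⟩ := h
  rcases M.eq_empty_or_nonempty with rfl | ⟨e₀, he₀⟩
  · simp
  refine le_csSup (bddAbove_card_isAdmissibleMatching G k) ⟨M, ⟨hM, ?_⟩, rfl⟩
  obtain ⟨S, hS⟩ : ∃ S, S = (matchingVerts M).image q := ⟨_, rfl⟩
  rw [← hS] at hcard
  have hout : ∀ e ∈ M, q e.out.1 ∈ S := fun e he => hS ▸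
    Finset.mem_image_of_mem q (mem_matchingVerts.2 ⟨e, he, Sym2.out_fst_mem e⟩)
  have hpart : ∀ i e, e ∈ M.filter (fun e => q e.out.1 = (S.equivFin.symm i : ℕ)) ↔
      e ∈ M ∧ q e.out.1 = (S.equivFin.symm i : ℕ) := fun i e => Finset.mem_filter
  have hdisj : ∀ i j, i ≠ j → Disjoint (M.filter fun e => q e.out.1 = (S.equivFin.symm i : ℕ))
      (M.filter fun e => q e.out.1 = (S.equivFin.symm j : ℕ)) := by
    intro i j hij
    refine Finset.disjoint_left.2 fun e he he' => hij ?_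
    refine S.equivFin.symm.injective (Subtype.ext ?_)
    rw [← ((hpart i e).1 he).2, ((hpart j e).1 he').2]
  have hunion : M = Finset.univ.biUnion
      fun i => M.filter fun e => q e.out.1 = (S.equivFin.symm i : ℕ) := by
    ext e
    simp only [Finset.mem_biUnion, Finset.mem_univ, true_and, Finset.mem_filter]
    constructor
    · intro he
      exact ⟨S.equivFin ⟨_, hout e he⟩, he, by simp⟩
    · rintro ⟨i, he, -⟩
      exact he
  have hne : ∀ i, (M.filter fun e => q e.out.1 = (S.equivFin.symm i : ℕ)).Nonempty := by
    intro i
    have hi := (S.equivFin.symm i).2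
    obtain ⟨v, hv, hvi⟩ := Finset.mem_image.1 (hS.subset hi)
    obtain ⟨e, he, hve⟩ := mem_matchingVerts.1 hv
    refine ⟨e, (hpart i e).2 ⟨he, ?_⟩⟩
    exact (hM.apply_out_eq hq he hve).trans hvi
  refine ⟨S.card, fun i => M.filter fun e => q e.out.1 = (S.equivFin.symm i : ℕ), hne, ?_, hdisj,
    ?_, ⟨Finset.card_pos.2 ⟨_, hout e₀ he₀⟩, fun i => Finset.card_pos.2 (hne i), ?_⟩, ?_⟩
  · convert hunion
  · intro i j hij e he e' he'
    refine hM.isGap ((hpart i e).1 he).1 ((hpart j e').1 he').1 ?_ ?_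
    · rintro rfl
      exact Finset.disjoint_left.1 (hdisj i j hij) he he'
    · intro u hu v hv huv
      refine hij (S.equivFin.symm.injective (Subtype.ext ?_))
      obtain ⟨he, hei⟩ := (hpart i e).1 he
      obtain ⟨he', hej⟩ := (hpart j e').1 he'
      rw [← hei, ← hej, hM.apply_out_eq hq he hu, hM.apply_out_eq hq he' hv]
      exact hq u (mem_matchingVerts.2 ⟨e, he, hu⟩) v (mem_matchingVerts.2 ⟨e', he', hv⟩) huv
  · rw [← Finset.card_biUnion fun i _ j _ hij => hdisj i j hij, ← hunion]
    omega
  · exact fun i => hG.induce _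

theorem IsEdgeMatching.le_aim (hG : G.IsAcyclic) {M : Finset (Sym2 V)} (hM : IsEdgeMatching G M)
    (hne : M.Nonempty) : M.card ≤ aim G M.card := by
  refine IsColouredAdmissible.card_le_aim (W := Finset.univ) hG
    ⟨hM, Finset.subset_univ _, fun _ => 0, fun _ _ _ _ _ => rfl, ?_⟩
  have : 0 < ((matchingVerts M).image fun _ => 0).card := by
    obtain ⟨e, he⟩ := hne
    exact Finset.card_pos.2 ⟨0, Finset.mem_image.2
      ⟨e.out.1, mem_matchingVerts.2 ⟨e, he, Sym2.out_fst_mem e⟩, rfl⟩⟩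
  omega

/-- The parts of an admissible matching `M` can be merged until there are exactly
`|M| - k + 1 = t + 1` of them, and they then form a colouring of the vertices. -/
theorem IsAdmissibleMatching.exists_colouring {M : Finset (Sym2 V)} {k t : ℕ}
    (h : IsAdmissibleMatching G k M) (ht : M.card = t + k) : ∃ q : V → ℕ,
      (∀ u ∈ matchingVerts M, ∀ v ∈ matchingVerts M, G.Adj u v → q u = q v) ∧
      (∀ v, q v ≤ t) ∧ ∀ j ≤ t, ∃ v ∈ matchingVerts M, q v = j := by
  classical
  obtain ⟨hM, r, P, hne, hMP, hdisj, hgap, ⟨hr, -, hsum⟩, -⟩ := h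
  have hmem : ∀ e, e ∈ M ↔ ∃ i, e ∈ P i := by
    intro e
    rw [hMP]
    simp
  have htr : t + 1 ≤ r := by
    have hcard : M.card ≤ ∑ i, (P i).card := by
      refine le_trans (le_of_eq ?_) (Finset.card_biUnion_le (s := Finset.univ) (t := P))
      exact congrArg Finset.card (by rw [hMP])
    have hsum : ∑ i, (P i).card ≤ r + k - 1 := hsum
    omega
  have huniq : ∀ {i j e e' v}, e ∈ P i → e' ∈ P j → v ∈ e → v ∈ e' → i = j := by
    intro i j e e' v he he' hv hv'
    by_contra hij
    have := hM.eq_of_mem ((hmem e).2 ⟨i, he⟩) ((hmem e').2 ⟨j, he'⟩) hv hv'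
    exact Finset.disjoint_left.1 (hdisj i j hij) he (this ▸ he')
  -- Truncation at `t` merges the parts with the indices `t, …, r - 1`.
  let q : V → ℕ := fun v =>
    if h : ∃ i, ∃ e ∈ P i, v ∈ e then min (h.choose : ℕ) t else 0
  have hq : ∀ {i e v}, e ∈ P i → v ∈ e → q v = min (i : ℕ) t := by
    intro i e v he hv
    have h : ∃ i, ∃ e ∈ P i, v ∈ e := ⟨i, e, he, hv⟩
    obtain ⟨e', he', hv'⟩ := h.choose_spec
    simp only [q, dif_pos h]
    rw [huniq he' he hv' hv]
  refine ⟨q, ?_, ?_, ?_⟩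
  · intro u hu v hv huv
    obtain ⟨e, he, hue⟩ := mem_matchingVerts.1 hu
    obtain ⟨e', he', hve⟩ := mem_matchingVerts.1 hv
    obtain ⟨i, hi⟩ := (hmem e).1 he
    obtain ⟨j, hj⟩ := (hmem e').1 he'
    rw [hq hi hue, hq hj hve]
    by_cases hij : i = j
    · rw [hij]
    · exact absurd huv ((hgap i j hij e hi e' hj).not_adj hue hve)
  · intro v
    simp only [q]
    split_ifs
    · exact min_le_right _ _
    · exact Nat.zero_le _
  · intro j hj
    obtain ⟨e, he⟩ := hne ⟨j, by omega⟩
    refine ⟨e.out.1, mem_matchingVerts.2 ⟨e, (hmem e).2 ⟨_, he⟩, Sym2.out_fst_mem e⟩, ?_⟩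
    rw [hq he (Sym2.out_fst_mem e)]
    exact min_eq_left hj

theorem IsEdgeMatching.card_matchingVerts {M : Finset (Sym2 V)} (hM : IsEdgeMatching G M) :
    (matchingVerts M).card = 2 * M.card := by
  classical
  induction M using Finset.induction_on with
  | empty => simp [matchingVerts]
  | insert e M he ih =>
    have hM' := hM.subset (Finset.subset_insert e M)
    have hnot : ∀ v ∈ e, v ∉ matchingVerts M := by
      intro v hv hvM
      obtain ⟨e', he', hv'⟩ := mem_matchingVerts.1 hvM
      exact he (hM.eq_of_mem (Finset.mem_insert_self e M) (Finset.mem_insert_of_mem he') hv hv' ▸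
        he')
    have hedge := hM.1 e (Finset.mem_insert_self e M)
    induction e with
    | h x y =>
    have hxy : x ≠ y := G.ne_of_adj hedge
    rw [matchingVerts_insert, Finset.card_insert_of_notMem, Finset.card_insert_of_notMem, ih hM',
      Finset.card_insert_of_notMem he]
    · ring
    · exact hnot y (by simp)
    · simp [hxy, hnot x (by simp)]

/-- Deleting the vertices in `Y` destroys at most `|Y|` edges of a matching. -/
theorem IsEdgeMatching.hasMatchingIn_sdiff [DecidableEq V] {M : Finset (Sym2 V)}
    (hM : IsEdgeMatching G M) (Y : Finset V) :
    HasMatchingIn G (M.card - Y.card) (matchingVerts M \ Y) := by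
  classical
  have h1 : (M.filter fun e => ∃ v ∈ Y, v ∈ e).card ≤ Y.card := by
    have hch : ∀ e : Sym2 V, ∃ v, (∃ v ∈ Y, v ∈ e) → v ∈ Y ∧ v ∈ e := by
      intro e
      by_cases h : ∃ v ∈ Y, v ∈ e
      · exact ⟨h.choose, fun _ => h.choose_spec⟩
      · exact ⟨e.out.1, fun h' => absurd h' h⟩
    choose f hf using hch
    refine Finset.card_le_card_of_injOn f (fun e he => (hf e (Finset.mem_filter.1 he).2).1) ?_
    intro e he e' he' hee
    have he := Finset.mem_filter.1 he
    have he' := Finset.mem_filter.1 he'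
    exact hM.eq_of_mem he.1 he'.1 (hf e he.2).2 (hee ▸ (hf e' he'.2).2)
  have h2 := Finset.card_filter_add_card_filter_not (s := M) fun e => ∃ v ∈ Y, v ∈ e
  refine (hM.subset (Finset.filter_subset (fun e => ¬ ∃ v ∈ Y, v ∈ e) M)).hasMatchingIn
    (by omega) ?_
  intro v hv
  obtain ⟨e, he, hve⟩ := mem_matchingVerts.1 hv
  obtain ⟨he, hY⟩ := Finset.mem_filter.1 he
  exact Finset.mem_sdiff.2 ⟨mem_matchingVerts.2 ⟨e, he, hve⟩, fun h => hY ⟨v, h, hve⟩⟩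

theorem IsEdgeMatching.card_filter_matchingVerts {M : Finset (Sym2 V)} (hM : IsEdgeMatching G M)
    {q : V → ℕ}
    (hq : ∀ u ∈ matchingVerts M, ∀ v ∈ matchingVerts M, G.Adj u v → q u = q v) (j : ℕ) :
    ((matchingVerts M).filter fun v => q v = j).card =
      2 * (M.filter fun e => q e.out.1 = j).card := by
  rw [← (hM.subset (Finset.filter_subset _ M)).card_matchingVerts]
  congr 1
  ext v
  simp only [Finset.mem_filter, mem_matchingVerts]
  constructor
  · rintro ⟨⟨e, he, hve⟩, hv⟩
    exact ⟨e, ⟨he, by rw [hM.apply_out_eq hq he hve, hv]⟩, hve⟩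
  · rintro ⟨e, ⟨he, hej⟩, hve⟩
    exact ⟨⟨e, he, hve⟩, by rw [← hM.apply_out_eq hq he hve, hej]⟩

/-- If `F` meets all `t + 1` colours, then a matching avoiding `F` has fewer edges than `M` in each
colour. -/
theorem IsEdgeMatching.not_range_subset_image [DecidableEq V] {M : Finset (Sym2 V)}
    (hM : IsEdgeMatching G M) {q : V → ℕ} {k t : ℕ} (ht : M.card = t + k)
    (hq : ∀ u ∈ matchingVerts M, ∀ v ∈ matchingVerts M, G.Adj u v → q u = q v)
    (hqt : ∀ v, q v ≤ t) {F : Finset V} (hF : F ⊆ matchingVerts M)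
    (hk : HasMatchingIn G k (matchingVerts M \ F)) :
    ¬ Finset.range (t + 1) ⊆ F.image q := by
  intro hsub
  obtain ⟨N, hN, hNk, hNA⟩ := hk
  have hNM : matchingVerts N ⊆ matchingVerts M := hNA.trans Finset.sdiff_subset
  have hlt : ∀ j ∈ Finset.range (t + 1), (N.filter fun e => q e.out.1 = j).card + 1 ≤
      (M.filter fun e => q e.out.1 = j).card := by
    intro j hj
    have h1 := hM.card_filter_matchingVerts hq j
    have h2 := hN.card_filter_matchingVerts
      (fun u hu v hv => hq u (hNM hu) v (hNM hv)) j
    have h3 : ((matchingVerts N).filter fun v => q v = j).card <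
        ((matchingVerts M).filter fun v => q v = j).card := by
      obtain ⟨v, hv, hvj⟩ := Finset.mem_image.1 (hsub hj)
      refine Finset.card_lt_card ((Finset.ssubset_iff_of_subset
        (Finset.filter_subset_filter _ hNM)).2 ⟨v, Finset.mem_filter.2 ⟨hF hv, hvj⟩, fun h => ?_⟩)
      exact (Finset.mem_sdiff.1 (hNA (Finset.mem_filter.1 h).1)).2 hv
    omega
  have hfib : ∀ A : Finset (Sym2 V), A.card = ∑ j ∈ Finset.range (t + 1),
      (A.filter fun e => q e.out.1 = j).card := fun A =>
    Finset.card_eq_sum_card_fiberwise fun e _ =>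
      Finset.mem_coe.2 (Finset.mem_range.2 (Nat.lt_succ_of_le (hqt _)))
  have hsum := Finset.sum_le_sum hlt
  rw [Finset.sum_add_distrib, ← hfib, ← hfib, Finset.sum_const, Finset.card_range, smul_eq_mul,
    mul_one] at hsum
  omega

end Admissible

/-! ### Regularity of squarefree powers -/

section Regularity

variable {K : Type*} [Field K] {V : Type*} [Fintype V]

theorem mem_edgeIdealSquarefreePower {G : SimpleGraph V} {k : ℕ} {f : MvPolynomial V K} :
    f ∈ edgeIdealSquarefreePower K G k ↔ ∀ m ∈ f.support, HasMatchingIn G k m.support := by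
  have hgen : {f : MvPolynomial V K | ∃ M : Finset (Sym2 V), IsEdgeMatching G M ∧ M.card = k ∧
      f = ∏ v ∈ matchingVerts M, X v} = (fun s => monomial s (1 : K)) ''
        {s | ∃ M, IsEdgeMatching G M ∧ M.card = k ∧ s = squarefreeExponent (matchingVerts M)} := by
    have hprod : ∀ A : Finset V, (∏ v ∈ A, X v : MvPolynomial V K) =
        monomial (squarefreeExponent A) 1 := by
      intro A
      rw [squarefreeExponent, monomial_sum_one]
      rfl
    ext f
    constructor
    · rintro ⟨M, hM, hk, rfl⟩
      exact ⟨_, ⟨M, hM, hk, rfl⟩, (hprod _).symm⟩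
    · rintro ⟨_, ⟨M, hM, hk, rfl⟩, rfl⟩
      exact ⟨M, hM, hk, (hprod _).symm⟩
  rw [edgeIdealSquarefreePower, hgen, mem_ideal_span_monomial_image]
  refine forall₂_congr fun m _ => ⟨?_, ?_⟩
  · rintro ⟨_, ⟨M, hM, hk, rfl⟩, h⟩
    exact ⟨M, hM, hk, squarefreeExponent_le_iff.1 h⟩
  · rintro ⟨M, hM, hk, h⟩
    exact ⟨_, ⟨M, hM, hk, rfl⟩, squarefreeExponent_le_iff.2 h⟩

theorem koszulChains_edgeIdealSquarefreePower (G : SimpleGraph V) (k i j : ℕ) :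
    koszulChains (edgeIdealSquarefreePower K G k) i j =
      supportChains K (HasMatchingIn G k) i j := by
  ext c
  constructor
  · intro h F m hm
    have hm := mem_support_iff.2 hm
    exact ⟨mem_edgeIdealSquarefreePower.1 (h F).1 m hm, (h F).2 m hm⟩
  · intro h F
    exact ⟨mem_edgeIdealSquarefreePower.2 fun m hm => (h F m (mem_support_iff.1 hm)).1,
      fun m hm => (h F m (mem_support_iff.1 hm)).2⟩

/-- Finite-dimensionality, without which the `finrank` in `gradedBetti` could vanish for a nonzero
`gradedTor`. -/
theorem finite_koszulChains (I : Ideal (MvPolynomial V K)) (i j : ℕ) :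
    Module.Finite K (koszulChains I i j) := by
  classical
  let B : Set (V →₀ ℕ) := Set.Iic (Finsupp.equivFunOnFinite.symm fun _ => j)
  have hB : B.Finite := Set.finite_Iic _
  have := hB.to_subtype
  let φ : (Finset V → MvPolynomial V K) →ₗ[K] (Finset V → B → K) :=
    LinearMap.pi fun F => LinearMap.pi fun m => (lcoeff K (m : V →₀ ℕ)).comp (LinearMap.proj F)
  refine FiniteDimensional.of_injective (φ.comp (koszulChains I i j).subtype) ?_
  rw [injective_iff_map_eq_zero]
  rintro ⟨c, hc⟩ h0
  refine Subtype.ext (funext fun F => ?_)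
  ext m
  by_contra hm
  have hm' := ((hc F).2 m (mem_support_iff.2 hm)).2
  have hmB : m ∈ B := fun v => by
    have := Finsupp.le_degree v m
    simp
    omega
  exact hm (congrFun (congrFun h0 F) ⟨m, hmB⟩)

variable [LinearOrder V]

theorem gradedBetti_eq_zero_iff (I : Ideal (MvPolynomial V K)) (i j : ℕ) :
    gradedBetti I i j = 0 ↔ koszulCycles I i j ≤ koszulBoundaries I i j := by
  have := finite_koszulChains I i j
  have : Module.Finite K (koszulCycles I i j) :=
    Submodule.finiteDimensional_of_le (inf_le_left : koszulCycles I i j ≤ koszulChains I i j)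
  rw [gradedBetti, Module.finrank_zero_iff, Submodule.Quotient.subsingleton_iff,
    Submodule.submoduleOf_eq_top]

theorem regularity_le_of_regLE {G : SimpleGraph V} {k n : ℕ}
    (h : RegLE K (HasMatchingIn G k) n) :
    regularity (edgeIdealSquarefreePower K G k) ≤ ((n : ℤ) : WithTop ℤ) := by
  refine sSup_le ?_
  rintro _ ⟨i, j, hij, rfl⟩
  rw [WithBot.coe_le_coe, WithTop.coe_le_coe]
  by_contra hlt
  refine hij ((gradedBetti_eq_zero_iff _ i j).2 ?_)
  rintro c ⟨hc, hc0⟩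
  rw [koszulChains_edgeIdealSquarefreePower] at hc
  obtain ⟨b, hb, hbc⟩ := h i j (by omega) c hc hc0
  rw [← koszulChains_edgeIdealSquarefreePower] at hb
  exact ⟨b, hb, hbc⟩

/-- A `k`-admissible matching `M` gives a nonzero class in homological degree `|M| - k` and internal
degree `2|M|`. -/
theorem IsAdmissibleMatching.le_regularity {G : SimpleGraph V} {k : ℕ} {M : Finset (Sym2 V)}
    (h : IsAdmissibleMatching G k M) (hk : k ≤ M.card) :
    (((M.card + k : ℕ) : ℤ) : WithTop ℤ) ≤ regularity (edgeIdealSquarefreePower K G k) := by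
  obtain ⟨t, ht⟩ : ∃ t, M.card = t + k := ⟨M.card - k, by omega⟩
  obtain ⟨q, hq, hqt, hsurj⟩ := h.exists_colouring ht
  obtain ⟨X, hX, hXc, hXq⟩ : ∃ X ⊆ matchingVerts M, X.card = t + 1 ∧
      X.image q = Finset.range (t + 1) := by
    choose x hxM hxq using hsurj
    let y : Fin (t + 1) → V := fun j => x j (Nat.le_of_lt_succ j.2)
    have hy : ∀ j, q (y j) = j := fun j => hxq _ _
    have hinj : Function.Injective y := fun i j hij => Fin.ext (by rw [← hy i, ← hy j, hij])
    refine ⟨Finset.univ.image y, ?_, ?_, ?_⟩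
    · intro v hv
      obtain ⟨j, -, rfl⟩ := Finset.mem_image.1 hv
      exact hxM _ _
    · rw [Finset.card_image_of_injective _ hinj, Finset.card_univ, Fintype.card_fin]
    · ext j
      simp only [Finset.mem_image, Finset.mem_univ, true_and, exists_exists_eq_and, hy,
        Finset.mem_range]
      exact ⟨fun ⟨i, hi⟩ => hi ▸ i.2, fun hj => ⟨⟨j, hj⟩, rfl⟩⟩
  obtain ⟨c, hc, hc0, hcb⟩ := exists_cycle_not_boundary (K := K) (P := HasMatchingIn G k)
    (fun v _ => hqt v) hX hXc hXq
    (fun v hv => by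
      have := h.1.hasMatchingIn_sdiff (X.erase v)
      rwa [Finset.card_erase_of_mem hv, hXc, ht, Nat.add_sub_cancel,
        Nat.add_sub_cancel_left] at this)
    (fun F hF hP => h.1.not_range_subset_image ht hq hqt hF hP)
  refine le_sSup ⟨t, (matchingVerts M).card, fun h0 => ?_, ?_⟩
  · rw [gradedBetti_eq_zero_iff] at h0
    rw [← koszulChains_edgeIdealSquarefreePower] at hc
    obtain ⟨b, hb, hbc⟩ := h0 ⟨hc, hc0⟩
    rw [SetLike.mem_coe, koszulChains_edgeIdealSquarefreePower] at hb
    exact hcb b hb hbc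
  · rw [h.1.card_matchingVerts, ht]
    congr 2
    push_cast
    ring

end Regularity

theorem mainTheorem2 (K : Type*) [Field K] {V : Type*} [Fintype V] [LinearOrder V]
    (G : SimpleGraph V) (hG : G.IsAcyclic) (k : ℕ) (hk : 1 ≤ k) (hkν : k ≤ matchingNumber G) :
    regularity (edgeIdealSquarefreePower K G k) =
      (((aim G k + k : ℕ) : ℤ) : WithTop ℤ) := by
  refine le_antisymm (regularity_le_of_regLE ?_) ?_
  · have := hG.regLE_hasMatchingIn K Finset.univ k (aim G k) fun M hM => hM.card_le_aim hG
    simpa only [Finset.univ_inter] using this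
  · obtain ⟨N, hN, hNk⟩ : ∃ N : Finset (Sym2 V), IsEdgeMatching G N ∧ N.card = k := by
      have hmem : matchingNumber G ∈
          {m : ℕ | ∃ M : Finset (Sym2 V), IsEdgeMatching G M ∧ M.card = m} :=
        Nat.sSup_mem ⟨0, ∅, ⟨by simp, by simp⟩, rfl⟩
          ⟨Fintype.card (Sym2 V), by rintro m ⟨M, -, rfl⟩; exact M.card_le_univ⟩
      obtain ⟨M, hM, hMν⟩ := hmem
      obtain ⟨N, hN, hNk⟩ := Finset.exists_subset_card_eq (hkν.trans hMν.ge)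
      exact ⟨N, hM.subset hN, hNk⟩
    have hka : k ≤ aim G k := by
      have := hN.le_aim hG (Finset.card_pos.1 (by omega))
      rwa [hNk] at this
    obtain ⟨M, hM, hMa⟩ : aim G k ∈
        {m : ℕ | ∃ M : Finset (Sym2 V), IsAdmissibleMatching G k M ∧ M.card = m} := by
      refine Nat.sSup_mem ?_ (bddAbove_card_isAdmissibleMatching G k)
      by_contra hne
      rw [Set.not_nonempty_iff_eq_empty] at hne
      rw [aim, hne, csSup_empty] at hka
      exact absurd hka (by simp; omega)
    rw [← hMa]
    exact hM.le_regularity (hMa ▸ hka)
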